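/- Let $S$ and $A$ be compact metric spaces with metrics $d_S,d_A$ and their Borel $\sigma$-algebras, and let $\mathcal M$ be a Markov decision process with state space $S$ and action space $A$: every state $s$ has a non-empty compact set $Av(s)\subseteq A$ of available actions, depending measurably on $s$, and $\Delta$ is a Markov kernel from $S\times A$ to $S$. Write $S\times Av=\{(s,a): a\in Av(s)\}$. Let $T\subseteq S$ be a measurable target set, $s_0\in S$ and $\xi\in[0,1]$. Let $V(s)=\sup_\pi \mathbb P^\pi_s[\Diamond T]$ be the supremum, over all history-dependent randomized strategies $\pi$, of the probability that the path started in $s$ visits $T$. For $(s,a)\in S\times Av$ let $V(s,a)=1$ if $s\in T$ and $V(s,a)=\int V\,d\Delta(s,a)$ otherwise. A state is reachable if it is the last state of a finite path from $s_0$, i.e. of a sequence $s_0a_0s_1a_1\cdots s_n$ with $a_i\in Av(s_i)$ and $s_{i+1}\in\operatorname{supp}\Delta(s_i,a_i)$. The total variation distance is $\delta_{TV}(\mu,\nu)=2\sup_Y|\mu(Y)-\nu(Y)|$. Assume the following. (A1) $d_\times$ is a (measurable) metric on $S\times Av$ that is compatible with $d_S,d_A$: there are $k,K\ge 0$ with $k\,d_A(a,a')\le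 d_\times((s,a),(s,a'))\le K\,d_A(a,a')$ and $k\,d_S(s,s')\le d_\times((s,a),(s',a))\le K\,d_S(s,s')$ whenever these pairs belong to $S\times Av$. (A2) For every state $s$, Lipschitz $f:Av(s)\to[0,1]$ and $\varepsilon>0$, a procedure $\mathrm{Approx}_\le$ returns a value in $[m-\varepsilon,m]$, where $m=\max_{a\in Av(s)}f(a)$. (A3) For every $(s,a)\in S\times Av$, every measurable $g:S\to[0,1]$ that is Lipschitz or of the form $g(s)=\max_{a\in Av(s)}F(s,a)$ with $F$ Lipschitz with respect to $d_\times$, and every $\varepsilon>0$, a procedure $\mathrm{Approx}_\le$ returns a value in $[e-\varepsilon,e]$, where $e=\int g\,d\Delta(s,a)$. (A4) The algorithm can decide whether $s\in T$. (B.VI) The oracle GetPair yields random pairs $(s_t,a_t)\in S\times Av$, which may depend on everything that happened before, such that for every $\varepsilon>0$, every reachable $s$ and every $a\in Av(s)$, almost surely there are infinitely many $t$ with $d_\times((s,a),(s_t,a_t))<\varepsilon$, $\delta_{TV}(\Delta(s,a),\Delta(s_t,a_t))<\varepsilon$ and, if $s\in T$, also $s_t\in T$. (C) For known constants $C_S,C_\times\ge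 0$, $|V(s)-V(s')|\le C_S\,d_S(s,s')$ for all states and $|V(s,a)-V(s',a')|\le C_\times\,d_\times((s,a),(s',a'))$ for all pairs in $S\times Av$. Let $\mathrm{prec}(t)>0$ be a sequence of precisions with $\mathrm{prec}(t)\to 0$. Consider the following algorithm. It keeps a finite set $\mathsf{Sampled}$ of pairs, initially empty, and stored bounds $\hat L$, initially $0$. These define $$L(s,a)=\max\Bigl(0,\max_{(s',a')\in\mathsf{Sampled}}\bigl(\hat L(s',a')-C_\times\, d_\times((s,a),(s',a'))\bigr)\Bigr),\qquad L(s)=\max_{a\in Av(s)}L(s,a).$$ While $\mathrm{Approx}_\le(L(s_0),\mathrm{prec}(t))\le\xi$, the algorithm gets a pair $(s,a)$ from GetPair. If $s\in T$, it sets $\hat L(s,\cdot)\leftarrow 1$. Otherwise it sets $\hat L(s,a)\leftarrow\max\bigl(\hat L(s,a),\ \mathrm{Approx}_\le(\int L\,d\Delta(s,a),\mathrm{prec}(t))\bigr)$. Then it adds $(s,a)$ to $\mathsf{Sampled}$ and increments $t$. When the loop ends, it answers "yes". Let $L_t$ denote the bound $L$ before iteration $t$ (the bounds obtained by repeating the loop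 body indefinitely). Then: 1. On every run, $L_t(s,a)\le L_{t+1}(s,a)\le V(s,a)$ for all $(s,a)\in S\times Av$ and $L_t(s)\le L_{t+1}(s)\le V(s)$ for all $s\in S$ and all $t$. If the algorithm answers "yes", then $V(s_0)>\xi$. 2. Almost surely, $L_t(s_0)\to V(s_0)$, and the algorithm answers "yes" if and only if $V(s_0)>\xi$. -/

import Mathlib

open MeasureTheory ProbabilityTheory Filter Topology

noncomputable section

namespace ReachMDP

/-- A continuous-space, discrete-time Markov decision process with state space `S` and action
space `A` (both compact metric spaces with their Borel sigma-algebras where this is used).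
`hit_measurable` is the standard measurability of the compact-valued map `av` (for such maps it is
equivalent to measurability of the set of all state-action pairs). -/
structure MDP (S A : Type*) [TopologicalSpace S] [MeasurableSpace S]
    [TopologicalSpace A] [MeasurableSpace A] where
  /-- the available actions of a state -/
  av : S → Set A
  av_nonempty : ∀ s, (av s).Nonempty
  av_compact : ∀ s, IsCompact (av s)
  hit_measurable : ∀ U : Set A, IsOpen U → MeasurableSet {s | (av s ∩ U).Nonempty}
  /-- the transition kernel -/
  trans : Kernel (S × A) S
  markov : IsMarkovKernel trans

section Paths

variable {S A : Type*}

/-- The first state of a finite path. -/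
def firstState {n : ℕ} (h : (Fin n → S × A) × S) : S :=
  (Fin.snoc (α := fun _ => S) (fun j => (h.1 j).1) h.2 : Fin (n + 1) → S) 0

/-- The last entry of a history of pairs. -/
def lastPair (n : ℕ) (x : Finset.Iic n → S × A) : S × A := x ⟨n, Finset.mem_Iic.2 le_rfl⟩

/-- A history of pairs and a successor state, in the format on which strategies operate. -/
def toHist (n : ℕ) (x : (Finset.Iic n → S × A) × S) : (Fin (n + 1) → S × A) × S :=
  (fun i => x.1 ⟨i, Finset.mem_Iic.2 (Nat.lt_succ_iff.1 i.2)⟩, x.2)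

lemma measurable_lastPair [MeasurableSpace S] [MeasurableSpace A] (n : ℕ) : Measurable (lastPair (S := S) (A := A) n) :=
  measurable_pi_apply _

lemma measurable_toHist [MeasurableSpace S] [MeasurableSpace A] (n : ℕ) : Measurable (toHist (S := S) (A := A) n) := by
  unfold toHist
  fun_prop

/-- The paths that eventually visit `T`. -/
def eventually (A : Type*) (T : Set S) : Set (ℕ → S × A) := {ρ | ∃ i, (ρ i).1 ∈ T}

end Paths

section Basic

variable {S A : Type*} [TopologicalSpace S] [MeasurableSpace S]
  [TopologicalSpace A] [MeasurableSpace A]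

instance (M : MDP S A) : IsMarkovKernel M.trans := M.markov

/-- The state-action pairs `(s, a)` with `a` available in `s`. -/
abbrev MDP.Pair (M : MDP S A) : Type _ := {p : S × A // p.2 ∈ M.av p.1}

/-- The state of a state-action pair. -/
abbrev MDP.Pair.state {M : MDP S A} (p : M.Pair) : S := p.1.1

/-- The pair `(s, a)`. -/
abbrev MDP.pair (M : MDP S A) (s : S) (a : M.av s) : M.Pair := ⟨(s, (a : A)), a.2⟩

/-- `s₀ a₀ s₁ a₁ ⋯ sₙ`, encoded as the pairs `(s₀, a₀), …, (sₙ₋₁, aₙ₋₁)` together with `sₙ`,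
is a finite path: all actions are available, and every state lies in the support of the preceding
transition. -/
def MDP.IsFinPath (M : MDP S A) {n : ℕ} (h : (Fin n → S × A) × S) : Prop :=
  ∀ i : Fin n, (h.1 i).2 ∈ M.av (h.1 i).1 ∧
    (Fin.snoc (α := fun _ => S) (fun j => (h.1 j).1) h.2 : Fin (n + 1) → S) i.succ
      ∈ (M.trans (h.1 i)).support

/-- The last states of the finite paths that start in `s₀`. -/
def MDP.reachable (M : MDP S A) (s₀ : S) : Set S :=
  {s | ∃ (n : ℕ) (h : (Fin n → S × A) × S), M.IsFinPath h ∧ firstState h = s₀ ∧ h.2 = s}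

/-- A (history-dependent, randomized) strategy. -/
structure Strategy (M : MDP S A) where
  /-- the distribution of the next action after a history ending in its last state -/
  act : ∀ n : ℕ, Kernel ((Fin n → S × A) × S) A
  markov : ∀ n, IsMarkovKernel (act n)
  support_subset : ∀ (n : ℕ) (h : (Fin n → S × A) × S), M.IsFinPath h →
    (act n h).support ⊆ M.av h.2

instance (M : MDP S A) (π : Strategy M) (n : ℕ) : IsMarkovKernel (π.act n) := π.markov n

/-- One step of the MDP under a strategy: the next state is drawn from the transition kernel, and
then the next action from the strategy. -/
def Strategy.stepKernel {M : MDP S A} (π : Strategy M) (n : ℕ) :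
    Kernel (Finset.Iic n → S × A) (S × A) :=
  (M.trans.comap (lastPair n) (measurable_lastPair n)) ⊗ₖ
    ((π.act (n + 1)).comap (toHist n) (measurable_toHist n))

instance {M : MDP S A} (π : Strategy M) (n : ℕ) : IsMarkovKernel (π.stepKernel n) := by
  unfold Strategy.stepKernel
  infer_instance

/-- The law of the first state-action pair, for the initial state `s`. -/
def Strategy.initLaw {M : MDP S A} (π : Strategy M) (s : S) : Measure (S × A) :=
  (π.act 0 (Fin.elim0, s)).map (fun a => (s, a))

/-- The probability measure on infinite paths induced by a strategy and an initial state. -/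
def Strategy.pathMeasure {M : MDP S A} (π : Strategy M) (s : S) : Measure (ℕ → S × A) :=
  Kernel.trajMeasure (X := fun _ => S × A) (π.initLaw s) π.stepKernel

/-- The value of a state: the supremal probability of reaching `T`. -/
def MDP.value (M : MDP S A) (T : Set S) (s : S) : ℝ :=
  ⨆ π : Strategy M, (π.pathMeasure s).real (eventually A T)

open Classical in
/-- The value of a state-action pair: the expected value of the successor, where, in accordance
with `V(s) = sup_a V(s, a)`, nothing remains to be done in a target state. -/
def MDP.pairValue (M : MDP S A) (T : Set S) (p : M.Pair) : ℝ :=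
  if p.state ∈ T then 1 else ∫ s', M.value T s' ∂(M.trans p.1)

end Basic

/-- The total variation distance `2 * sup_Y |μ Y - ν Y|`. -/
def tvDist {X : Type*} [MeasurableSpace X] (μ ν : Measure X) : ℝ :=
  2 * ⨆ Y : {Y : Set X // MeasurableSet Y}, |μ.real Y.1 - ν.real Y.1|

section Metric

variable {S A : Type*} [MetricSpace S] [MeasurableSpace S] [MetricSpace A] [MeasurableSpace A]

/-- A metric on the state-action pairs that is compatible with the metrics of `S` and `A`. -/
structure PairMetric (M : MDP S A) where
  /-- the distance -/
  d : M.Pair → M.Pair → ℝ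
  eq_zero_iff : ∀ p q, d p q = 0 ↔ p = q
  symm : ∀ p q, d p q = d q p
  triangle : ∀ p q r, d p r ≤ d p q + d q r
  compatible : ∃ k K : ℝ, 0 ≤ k ∧ 0 ≤ K ∧
    (∀ p q : M.Pair, p.1.1 = q.1.1 →
      k * dist p.1.2 q.1.2 ≤ d p q ∧ d p q ≤ K * dist p.1.2 q.1.2) ∧
    (∀ p q : M.Pair, p.1.2 = q.1.2 →
      k * dist p.1.1 q.1.1 ≤ d p q ∧ d p q ≤ K * dist p.1.1 q.1.1)
  measurable : ∀ p, Measurable (d p)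

variable {M : MDP S A}

/-- A state function induced by a state-action function: the maximum over available actions. -/
def maxOver (F : M.Pair → ℝ) (s : S) : ℝ := ⨆ a : M.av s, F (M.pair s a)

/-- The approximation procedures. The first argument is the index of the iteration in which the
procedure is called: the result need not depend on the approximated quantity alone. -/
structure Approx (M : MDP S A) where
  /-- approximation of `max_{a ∈ Av(s)} f(a)` up to a precision -/
  maxAv : ℕ → (s : S) → (M.av s → ℝ) → ℝ → ℝ
  /-- approximation of the expectation of `g` over the successors of a pair up to a precision -/
  exp : ℕ → M.Pair → (S → ℝ) → ℝ → ℝ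

/-- Maximum approximation: the maximum of a Lipschitz function `f : Av(s) → [0, 1]` is
under-approximated up to any given precision. -/
def Approx.MaxApprox (O : Approx M) : Prop :=
  ∀ (t : ℕ) (s : S) (f : M.av s → ℝ), (∀ a, f a ∈ Set.Icc (0 : ℝ) 1) →
    (∃ K, LipschitzWith K f) → ∀ ε > 0,
      0 ≤ (⨆ a, f a) - O.maxAv t s f ε ∧ (⨆ a, f a) - O.maxAv t s f ε ≤ ε

/-- The functions `g : S → [0, 1]` to which transition approximation applies: measurable, and
Lipschitz or the maximum over available actions of a Lipschitz state-action function. -/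
def PairMetric.Admissible (D : PairMetric M) (g : S → ℝ) : Prop :=
  Measurable g ∧ (∀ s, g s ∈ Set.Icc (0 : ℝ) 1) ∧
    ((∃ K, LipschitzWith K g) ∨
      ∃ (F : M.Pair → ℝ) (K : ℝ), (∀ p q, |F p - F q| ≤ K * D.d p q) ∧ g = maxOver F)

/-- Transition approximation: the successor expectation of an admissible function is
under-approximated up to any given precision. -/
def Approx.TransApprox (O : Approx M) (D : PairMetric M) : Prop :=
  ∀ (t : ℕ) (p : M.Pair) (g : S → ℝ), D.Admissible g → ∀ ε > 0,
    0 ≤ (∫ s', g s' ∂(M.trans p.1)) - O.exp t p g ε ∧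
      (∫ s', g s' ∂(M.trans p.1)) - O.exp t p g ε ≤ ε

/-- State-action sampling: near every reachable pair, in metric and in total variation, a pair is
sampled again and again almost surely, and near a reachable target state a target state is. -/
def Sampling (D : PairMetric M) (T : Set S) (s₀ : S) {Ω : Type*} [MeasurableSpace Ω]
    (P : Measure Ω) (getPair : ℕ → Ω → M.Pair) : Prop :=
  ∀ ε > 0, ∀ p : M.Pair, p.state ∈ M.reachable s₀ →
    ∀ᵐ ω ∂P, ∃ᶠ t in atTop, D.d p (getPair t ω) < ε ∧
      tvDist (M.trans p.1) (M.trans (getPair t ω).1) < ε ∧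
      (p.state ∈ T → (getPair t ω).state ∈ T)

/-- Value Lipschitz continuity, with constants `CS` and `CP`. -/
def ValueLipschitz (D : PairMetric M) (T : Set S) (CS CP : ℝ) : Prop :=
  (∀ s s', |M.value T s - M.value T s'| ≤ CS * dist s s') ∧
    ∀ p q, |M.pairValue T p - M.pairValue T q| ≤ CP * D.d p q

/-- The variables of the algorithm: the sampled pairs and the stored bounds. -/
structure VIState (M : MDP S A) where
  /-- the set `Sampled` -/
  sampled : Finset M.Pair
  /-- the stored bounds -/
  stored : M.Pair → ℝ

open Classical in
/-- The extrapolated lower bound of a pair: the maximum of `0` and of the values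
`stored q - CP * d(p, q)` for the sampled pairs `q`. -/
def VIState.pairBound (D : PairMetric M) (CP : ℝ) (σ : VIState M) (p : M.Pair) : ℝ :=
  (insert 0 (σ.sampled.image fun q => σ.stored q - CP * D.d p q)).max'
    (Finset.insert_nonempty _ _)

/-- The extrapolated lower bound of a state. -/
def VIState.bound (D : PairMetric M) (CP : ℝ) (σ : VIState M) (s : S) : ℝ :=
  maxOver (σ.pairBound D CP) s

open Classical in
/-- The body of the loop, executed with the sampled pair `p` in iteration `t`. -/
def VIState.update (D : PairMetric M) (CP : ℝ) (T : Set S) (O : Approx M) (prec : ℕ → ℝ)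
    (t : ℕ) (p : M.Pair) (σ : VIState M) : VIState M where
  sampled := insert p σ.sampled
  stored :=
    if p.state ∈ T then fun q => if q.state = p.state then 1 else σ.stored q
    else Function.update σ.stored p (max (σ.stored p) (O.exp t p (σ.bound D CP) (prec t)))

/-- The variables before iteration `t` (counted from `0`), if the loop has not been left. -/
def run (D : PairMetric M) (CP : ℝ) (T : Set S) (O : Approx M) (prec : ℕ → ℝ)
    (pairs : ℕ → M.Pair) : ℕ → VIState M
  | 0 => ⟨∅, fun _ => 0⟩
  | t + 1 => (run D CP T O prec pairs t).update D CP T O prec t (pairs t)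

/-- The algorithm answers `yes`: in some iteration the condition
`Approx(L(s₀), prec t) ≤ ξ` for continuing the loop fails. -/
def AnswersYes (D : PairMetric M) (CP : ℝ) (T : Set S) (O : Approx M) (prec : ℕ → ℝ)
    (pairs : ℕ → M.Pair) (s₀ : S) (ξ : ℝ) : Prop :=
  ∃ t, ¬ O.maxAv t s₀
    (fun a => (run D CP T O prec pairs t).pairBound D CP (M.pair s₀ a)) (prec t) ≤ ξ

end Metric

end ReachMDP

end

/-! Soundness is an invariant: every stored bound is at most `M.pairValue T`. Extrapolation keeps
this because the pair value is `CP`-Lipschitz, and the update keeps it because `L ≤ V` may be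
integrated. Passing from pairs to states needs the Bellman inequality `pairValue_le_value`.

For convergence, let `horizonValue k` be the backward-induction value with `k` steps to go. Two
facts suffice: its supremum over `k` is the value (`ofReal_value`), and at reachable states it lies
below the supremum over `t` of the bounds (`horizonValue_le_iSup_bound_run`). The second is an
induction on `k`. Monotone convergence reduces the integral of the limit bound to that of one bound
`L_{t₀}`. A later sample close to the given pair in metric and in total variation then stores at
least this integral, up to the precision, the variation error and the extrapolation loss, all
arbitrarily small.

The first fact carries the measure theory. No strategy beats backward induction
(`traj_visits_le_horizonPairValue`), but attaining it up to `ε` requires actions that depend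
measurably on the state. As the kernel is only measurable, `horizonValue k` need not be Borel; its
strict superlevel sets are analytic, a property preserved by projection and by integration against a
kernel (`UpperSemianalytic.lintegral_kernel`). Analytic sets are universally measurable, and a
capacity argument provides measurable selections off a set of small measure
(`exists_measurable_selector_of_analyticSet`). Hence near-optimal policies exist
(`exists_nearly_optimal_policy`).

Finally, the sampling assumption has one null set per pair, for uncountably many pairs. A maximal
family of pairs with disjoint neighbourhoods is countable, since each neighbourhood is hit with
positive probability at some time. Countably many pairs therefore control all of them, and one null
set suffices (`Sampling.ae_forall_frequently`). -/

noncomputable section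

namespace ReachMDP

/-! ### Measurable selections of closed-valued maps -/

section Selection

variable {X Y : Type*} [MeasurableSpace X] [MetricSpace Y] [SecondCountableTopology Y]
  [Nonempty Y]

open TopologicalSpace in
/-- Refinement step of the Kuratowski–Ryll-Nardzewski construction. -/
lemma exists_refined_index (Φ : X → Set Y)
    (hmeas : ∀ U : Set Y, IsOpen U → MeasurableSet {x | (Φ x ∩ U).Nonempty})
    {r : ℝ} (hr : 0 < r) (N : X → ℕ) (hN : Measurable N)
    (hhit : ∀ x, (Φ x ∩ Metric.ball (denseSeq Y (N x)) r).Nonempty) :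
    ∃ N' : X → ℕ, Measurable N' ∧
      (∀ x, (Φ x ∩ Metric.ball (denseSeq Y (N' x)) (r / 2)).Nonempty) ∧
      ∀ x, dist (denseSeq Y (N x)) (denseSeq Y (N' x)) < 2 * r := by
  classical
  have hex : ∀ x, ∃ k, (Φ x ∩ Metric.ball (denseSeq Y k) (r / 2)).Nonempty ∧
      dist (denseSeq Y (N x)) (denseSeq Y k) < 2 * r := by
    intro x
    obtain ⟨y, hyΦ, hy⟩ := hhit x
    obtain ⟨k, hk⟩ := (denseRange_denseSeq Y).exists_dist_lt y (half_pos hr)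
    refine ⟨k, ⟨y, hyΦ, hk⟩, ?_⟩
    have := dist_triangle (denseSeq Y (N x)) y (denseSeq Y k)
    rw [Metric.mem_ball, dist_comm] at hy
    linarith
  -- Taking the least admissible index makes the choice measurable: each index is admissible on a
  -- measurable set.
  refine ⟨fun x => Nat.find (hex x), measurable_find hex fun k => ?_,
    fun x => (Nat.find_spec (hex x)).1, fun x => (Nat.find_spec (hex x)).2⟩
  exact (hmeas _ Metric.isOpen_ball).inter (hN (MeasurableSet.of_discrete
    (s := {m | dist (denseSeq Y m) (denseSeq Y k) < 2 * r})))

open TopologicalSpace in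
/-- The Kuratowski–Ryll-Nardzewski selection theorem. -/
theorem exists_measurable_selection [CompleteSpace Y] [MeasurableSpace Y] [BorelSpace Y]
    (Φ : X → Set Y) (hne : ∀ x, (Φ x).Nonempty) (hcl : ∀ x, IsClosed (Φ x))
    (hmeas : ∀ U : Set Y, IsOpen U → MeasurableSet {x | (Φ x ∩ U).Nonempty}) :
    ∃ f : X → Y, Measurable f ∧ ∀ x, f x ∈ Φ x := by
  classical
  have hex : ∀ x, ∃ k, (Φ x ∩ Metric.ball (denseSeq Y k) 1).Nonempty := by
    intro x
    obtain ⟨y, hy⟩ := hne x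
    obtain ⟨k, hk⟩ := (denseRange_denseSeq Y).exists_dist_lt y one_pos
    exact ⟨k, y, hy, hk⟩
  have hpos : ∀ n : ℕ, (0 : ℝ) < 1 / 2 ^ n := fun n => by positivity
  let Idx (n : ℕ) := {N : X → ℕ // Measurable N ∧
    ∀ x, (Φ x ∩ Metric.ball (denseSeq Y (N x)) (1 / 2 ^ n)).Nonempty}
  have hstep : ∀ n (N : Idx n), ∃ N' : Idx (n + 1),
      ∀ x, dist (denseSeq Y (N.1 x)) (denseSeq Y (N'.1 x)) < 2 * (1 / 2 ^ n) := by
    intro n N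
    obtain ⟨N', h1, h2, h3⟩ := exists_refined_index Φ hmeas (hpos n) N.1 N.2.1 N.2.2
    refine ⟨⟨N', h1, fun x => ?_⟩, h3⟩
    have := h2 x
    rwa [div_div, ← pow_succ] at this
  choose next hnext using hstep
  let N₀ : Idx 0 := ⟨fun x => Nat.find (hex x),
    measurable_find hex fun k => hmeas _ Metric.isOpen_ball,
    fun x => by simpa using Nat.find_spec (hex x)⟩
  let N : ∀ n, Idx n := fun n => Nat.rec N₀ (fun n N => next n N) n
  let g : ℕ → X → Y := fun n x => denseSeq Y ((N n).1 x)
  have hg : ∀ n, Measurable (g n) := fun n =>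
    (measurable_from_nat (f := denseSeq Y)).comp (N n).2.1
  have hdist : ∀ x n, dist (g n x) (g (n + 1) x) ≤ 2 * (1 / 2) ^ n := fun x n => by
    have := (hnext n (N n) x).le
    simpa only [one_div, inv_pow] using this
  have hcauchy : ∀ x, CauchySeq fun n => g n x := fun x =>
    cauchySeq_of_le_geometric (1 / 2) 2 (by norm_num) (hdist x)
  choose f hf using fun x => cauchySeq_tendsto_of_complete (hcauchy x)
  refine ⟨f, measurable_of_tendsto_metrizable hg (tendsto_pi_nhds.2 hf), fun x => ?_⟩
  -- The approximants `g n x` need not lie in `Φ x`, but points of `Φ x` within `1 / 2 ^ n` of them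
  -- have the same limit, and `Φ x` is closed.
  choose y hyΦ hy using fun n => (N n).2.2 x
  refine (hcl x).mem_of_tendsto (f := y) (b := atTop) ?_ (Eventually.of_forall hyΦ)
  have h0 : Tendsto (fun n => dist (y n) (g n x)) atTop (𝓝 0) := by
    refine squeeze_zero (fun _ => dist_nonneg) (fun n => (Metric.mem_ball.1 (hy n)).le) ?_
    simpa only [one_div, inv_pow] using
      tendsto_pow_atTop_nhds_zero_of_lt_one (r := (1 / 2 : ℝ)) (by norm_num) (by norm_num)
  exact (tendsto_iff_of_dist h0).2 (hf x)

open TopologicalSpace in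
/-- A Castaing representation: the values of a measurable closed-valued map are the closures of
countably many measurable selections. -/
theorem exists_dense_measurable_selections [CompleteSpace Y] [MeasurableSpace Y] [BorelSpace Y]
    (Φ : X → Set Y) (hne : ∀ x, (Φ x).Nonempty) (hcl : ∀ x, IsClosed (Φ x))
    (hmeas : ∀ U : Set Y, IsOpen U → MeasurableSet {x | (Φ x ∩ U).Nonempty}) :
    ∃ f : ℕ → X → Y, (∀ n, Measurable (f n)) ∧ (∀ n x, f n x ∈ Φ x) ∧
      ∀ x, Φ x ⊆ closure (Set.range fun n => f n x) := by
  classical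
  let B (n : ℕ) : Set Y :=
    Metric.ball (denseSeq Y n.unpair.1) (1 / ((n.unpair.2 : ℝ) + 1))
  have hB : ∀ n, IsOpen (B n) := fun n => Metric.isOpen_ball
  -- A selection of `Ψ n` passes through the closure of the `n`-th ball whenever `Φ x` meets that
  -- ball. The closure gives closed values and is invisible to open test sets, so measurability
  -- survives.
  let Ψ (n : ℕ) (x : X) : Set Y :=
    if (Φ x ∩ B n).Nonempty then closure (Φ x ∩ B n) else Φ x
  have hsub : ∀ n x, Ψ n x ⊆ Φ x := fun n x => by
    dsimp only [Ψ]
    split_ifs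
    · exact closure_minimal Set.inter_subset_left (hcl x)
    · exact subset_rfl
  have hsel : ∀ n, ∃ f : X → Y, Measurable f ∧ ∀ x, f x ∈ Ψ n x := by
    intro n
    refine exists_measurable_selection (Ψ n) (fun x => ?_) (fun x => ?_) fun U hU => ?_
    · dsimp only [Ψ]
      split_ifs with h
      · exact h.closure
      · exact hne x
    · dsimp only [Ψ]
      split_ifs
      · exact isClosed_closure
      · exact hcl x
    · have : {x | (Ψ n x ∩ U).Nonempty} =
          {x | (Φ x ∩ (B n ∩ U)).Nonempty} ∪
            ({x | (Φ x ∩ B n).Nonempty}ᶜ ∩ {x | (Φ x ∩ U).Nonempty}) := by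
        ext x
        by_cases h : (Φ x ∩ B n).Nonempty
        · simp only [Ψ, h, if_true, Set.mem_ofPred_eq, Set.mem_union, Set.mem_inter_iff,
            Set.mem_compl_iff, not_true, false_and, or_false, closure_inter_open_nonempty_iff hU,
            Set.inter_assoc]
        · have h' : ¬ (Φ x ∩ (B n ∩ U)).Nonempty := fun ⟨y, hy⟩ => h ⟨y, hy.1, hy.2.1⟩
          simp only [Ψ, h, if_false, Set.mem_ofPred_eq, Set.mem_union, Set.mem_inter_iff,
            Set.mem_compl_iff, not_false_eq_true, true_and, h', false_or]
      rw [this]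
      exact (hmeas _ ((hB n).inter hU)).union ((hmeas _ (hB n)).compl.inter (hmeas _ hU))
  choose f hfm hf using hsel
  refine ⟨f, hfm, fun n x => hsub n x (hf n x), fun x y hy => ?_⟩
  rw [Metric.mem_closure_iff]
  intro ε hε
  obtain ⟨m, hm⟩ := exists_nat_one_div_lt (half_pos hε)
  obtain ⟨k, hk⟩ := (denseRange_denseSeq Y).exists_dist_lt y
    (show (0 : ℝ) < 1 / ((m : ℝ) + 1) by positivity)
  refine ⟨_, ⟨Nat.pair k m, rfl⟩, ?_⟩
  have hyB : y ∈ B (Nat.pair k m) := by simpa [B] using hk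
  have hmem := hf (Nat.pair k m) x
  have hne' : (Φ x ∩ B (Nat.pair k m)).Nonempty := ⟨y, hy, hyB⟩
  simp only [Ψ, hne', if_true] at hmem
  have h1 : f (Nat.pair k m) x ∈ Metric.closedBall (denseSeq Y k) (1 / ((m : ℝ) + 1)) := by
    refine closure_minimal ?_ Metric.isClosed_closedBall hmem
    refine Set.inter_subset_right.trans ?_
    simpa [B] using Metric.ball_subset_closedBall
  rw [Metric.mem_closedBall, dist_comm] at h1
  have := dist_triangle y (denseSeq Y k) (f (Nat.pair k m) x)
  linarith

end Selection

/-! ### Measurability of maxima over available actions -/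

section MaxOver

variable {S A : Type*} [MetricSpace S] [MeasurableSpace S]
  [MetricSpace A] [CompactSpace A] [MeasurableSpace A] [BorelSpace A]

/-- The maximum over available actions of a measurable state-action function that is continuous
in the action is measurable. -/
lemma measurable_maxOver (M : MDP S A) (F : M.Pair → ℝ) (hF : Measurable F)
    (hcont : ∀ s, Continuous fun a : M.av s => F (M.pair s a))
    (hbdd : ∀ s, BddAbove (Set.range fun a : M.av s => F (M.pair s a))) :
    Measurable (maxOver F) := by
  rcases isEmpty_or_nonempty S with hS | ⟨⟨s₁⟩⟩
  · exact measurable_of_empty _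
  have : Nonempty A := ⟨(M.av_nonempty s₁).some⟩
  obtain ⟨f, hfm, hf, hd⟩ := exists_dense_measurable_selections M.av M.av_nonempty
    (fun s => (M.av_compact s).isClosed) M.hit_measurable
  have hbdd' : ∀ s, BddAbove (Set.range fun n => F (M.pair s ⟨f n s, hf n s⟩)) := fun s =>
    (hbdd s).mono (by rintro _ ⟨n, rfl⟩; exact ⟨_, rfl⟩)
  have heq : maxOver F = fun s => ⨆ n, F (M.pair s ⟨f n s, hf n s⟩) := by
    funext s
    have : Nonempty (M.av s) := (M.av_nonempty s).to_subtype
    refine le_antisymm (ciSup_le fun a => ?_) (ciSup_le fun n => le_ciSup (hbdd s) _)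
    have hdense : DenseRange fun n => (⟨f n s, hf n s⟩ : M.av s) := by
      intro b
      rw [closure_subtype, ← Set.range_comp]
      exact hd s b.2
    have hclosed : IsClosed {b : M.av s | F (M.pair s b) ≤
        ⨆ n, F (M.pair s ⟨f n s, hf n s⟩)} := isClosed_le (hcont s) continuous_const
    exact hclosed.closure_subset_iff.2 (by rintro _ ⟨n, rfl⟩; exact le_ciSup (hbdd' s) n)
      (hdense a)
  rw [heq]
  exact Measurable.iSup fun n => hF.comp
    ((measurable_id.prodMk (hfm n)).subtype_mk)

end MaxOver

/-! ### Capacitability and universal measurability of analytic sets -/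

section Capacity

open scoped ENNReal

/-- The sequences whose first `j` entries are bounded by those of `n`. -/
def boundedPrefix (n : ℕ → ℕ) (j : ℕ) : Set (ℕ → ℕ) := {z | ∀ i < j, z i ≤ n i}

lemma boundedPrefix_congr {n n' : ℕ → ℕ} {j : ℕ} (h : ∀ i < j, n i = n' i) :
    boundedPrefix n j = boundedPrefix n' j := by
  ext z
  exact forall₂_congr fun i hi => by rw [h i hi]

lemma boundedPrefix_anti (n : ℕ → ℕ) : Antitone (boundedPrefix n) :=
  fun _ _ hjk _ hz i hi => hz i (hi.trans_le hjk)

lemma boundedPrefix_update_succ (n : ℕ → ℕ) (j m : ℕ) :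
    boundedPrefix (Function.update n j m) (j + 1) = boundedPrefix n j ∩ {z | z j ≤ m} := by
  ext z
  simp only [boundedPrefix, Set.mem_ofPred_eq, Set.mem_inter_iff]
  constructor
  · intro h
    refine ⟨fun i hi => ?_, by simpa using h j j.lt_succ_self⟩
    simpa [Function.update_of_ne hi.ne] using h i (hi.trans j.lt_succ_self)
  · rintro ⟨h1, h2⟩ i hi
    rcases (Nat.lt_succ_iff.1 hi).eq_or_lt with rfl | hi'
    · simpa using h2
    · simpa [Function.update_of_ne hi'.ne] using h1 i hi'

variable {α : Type*} [TopologicalSpace α]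

/-- The closed sets `closure (g '' boundedPrefix n j)` shrink to the image of a compact box. -/
lemma iInter_closure_image_boundedPrefix [T2Space α] [FirstCountableTopology α]
    {g : (ℕ → ℕ) → α} (hg : Continuous g) (n : ℕ → ℕ) :
    ⋂ j, closure (g '' boundedPrefix n j) = g '' Set.univ.pi fun i => Set.Iic (n i) := by
  refine Set.Subset.antisymm (fun x hx => ?_) ?_
  · obtain ⟨U, hU⟩ := (𝓝 x).exists_antitone_basis
    have hz : ∀ j, ∃ z ∈ boundedPrefix n j, g z ∈ U j := fun j => by
      have := mem_closure_iff_nhds.1 (Set.mem_iInter.1 hx j) (U j) (hU.1.mem_of_mem trivial)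
      obtain ⟨_, hyU, z, hz, rfl⟩ := this
      exact ⟨z, hz, hyU⟩
    choose z hzn hzU using hz
    -- Coordinate `i` of `z j` is controlled by `n i` only for `j > i`; adding the finitely many
    -- remaining values puts all `z j` into one compact box.
    let m : ℕ → ℕ := fun i => n i + ∑ j ∈ Finset.range (i + 1), z j i
    have hzm : ∀ j, z j ∈ Set.univ.pi fun i => Set.Iic (m i) := by
      intro j i _
      rcases lt_or_ge i j with hij | hij
      · exact (hzn j i hij).trans (Nat.le_add_right _ _)
      · refine le_trans ?_ (Nat.le_add_left _ _)
        exact Finset.single_le_sum (f := fun j => z j i) (fun _ _ => Nat.zero_le _)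
          (Finset.mem_range.2 (Nat.lt_succ_of_le hij))
    have hcomp : IsCompact (Set.univ.pi fun i => Set.Iic (m i)) :=
      isCompact_univ_pi fun i => (Set.finite_Iic (m i)).isCompact
    obtain ⟨y, -, φ, hφ, hlim⟩ := hcomp.tendsto_subseq hzm
    refine ⟨y, fun i _ => ?_, ?_⟩
    · have hi : Tendsto (fun k => z (φ k) i) atTop (𝓝 (y i)) :=
        ((continuous_apply i).tendsto y).comp hlim
      refine le_of_tendsto hi ?_
      filter_upwards [eventually_gt_atTop i] with k hk
      exact hzn (φ k) i (hk.trans_le (hφ.id_le k))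
    · exact tendsto_nhds_unique ((hg.tendsto y).comp hlim)
        ((hU.tendsto hzU).comp hφ.tendsto_atTop)
  · refine Set.subset_iInter fun j => (Set.image_mono ?_).trans subset_closure
    exact fun z hz i _ => hz i trivial

/-- Measures are capacities: a lower bound on the measure of the range of a map on the Baire space
persists on the images of suitable sets of bounded prefixes. -/
lemma exists_lt_measure_image_boundedPrefix {α : Type*} [MeasurableSpace α] (g : (ℕ → ℕ) → α) (μ : Measure α) {c : ℝ≥0∞}
    (hc : c < μ (Set.range g)) : ∃ n : ℕ → ℕ, ∀ j, c < μ (g '' boundedPrefix n j) := by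
  classical
  have hstep : ∀ (j : ℕ) (n : ℕ → ℕ), c < μ (g '' boundedPrefix n j) →
      ∃ m, c < μ (g '' boundedPrefix (Function.update n j m) (j + 1)) := by
    intro j n h
    have hU : g '' boundedPrefix n j = ⋃ m, g '' (boundedPrefix n j ∩ {z | z j ≤ m}) := by
      rw [← Set.image_iUnion, ← Set.inter_iUnion]
      congr 1
      refine (Set.inter_eq_left.2 fun z _ => Set.mem_iUnion.2 ⟨z j, le_refl (z j)⟩).symm
    have hmono : Monotone fun m => g '' (boundedPrefix n j ∩ {z | z j ≤ m}) := fun a b hab =>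
      Set.image_mono (Set.inter_subset_inter_right _ fun z (hz : z j ≤ a) => hz.trans hab)
    -- Continuity from below holds for increasing sequences of arbitrary sets, so the images need
    -- not be measurable.
    rw [hU, hmono.measure_iUnion] at h
    obtain ⟨m, hm⟩ := lt_iSup_iff.1 h
    exact ⟨m, by rwa [boundedPrefix_update_succ]⟩
  choose m hm using hstep
  -- Stage `j + 1` changes only coordinate `j`, so the diagonal sequence agrees with stage `j` on
  -- its first `j` entries.
  let N : ∀ j, {n : ℕ → ℕ // c < μ (g '' boundedPrefix n j)} := fun j =>
    Nat.rec ⟨0, by simpa [boundedPrefix, Set.image_univ] using hc⟩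
      (fun j n => ⟨Function.update n.1 j (m j n.1 n.2), hm j n.1 n.2⟩) j
  have hstab : ∀ i k, (N (i + 1 + k)).1 i = (N (i + 1)).1 i := by
    intro i k
    induction k with
    | zero => rfl
    | succ k ih =>
      rw [← ih]
      exact Function.update_of_ne (show i ≠ i + 1 + k by omega) _ _
  refine ⟨fun i => (N (i + 1)).1 i, fun j => ?_⟩
  rw [boundedPrefix_congr (n' := (N j).1)]
  · exact (N j).2
  · intro i hi
    obtain ⟨k, rfl⟩ := Nat.exists_eq_add_of_le (Nat.succ_le_of_lt hi)
    exact (hstab i k).symm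

variable [MeasurableSpace α] [OpensMeasurableSpace α]

/-- Passing to closures supplies the measurability that continuity from above requires; the limit
costs the strictness of the inequality. -/
lemma le_measure_iInter_closure {g : (ℕ → ℕ) → α} {μ : Measure α} [IsFiniteMeasure μ] {c : ℝ≥0∞}
    {n : ℕ → ℕ} (hn : ∀ j, c < μ (g '' boundedPrefix n j)) :
    c ≤ μ (⋂ j, closure (g '' boundedPrefix n j)) := by
  rw [Antitone.measure_iInter (fun i j hij => closure_mono (Set.image_mono
    (boundedPrefix_anti n hij))) (fun j => isClosed_closure.measurableSet.nullMeasurableSet)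
    ⟨0, measure_ne_top _ _⟩]
  exact le_iInf fun j => (hn j).le.trans (measure_mono subset_closure)

variable [T2Space α] [FirstCountableTopology α]

/-- Inner approximation of the range of a continuous map on the Baire space. -/
lemma exists_le_measure_image_box {g : (ℕ → ℕ) → α} (hg : Continuous g) (μ : Measure α)
    [IsFiniteMeasure μ] {c : ℝ≥0∞} (hc : c < μ (Set.range g)) :
    ∃ n : ℕ → ℕ, c ≤ μ (g '' Set.univ.pi fun i => Set.Iic (n i)) := by
  obtain ⟨n, hn⟩ := exists_lt_measure_image_boundedPrefix g μ hc
  exact ⟨n, iInter_closure_image_boundedPrefix hg n ▸ le_measure_iInter_closure hn⟩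

/-- Analytic sets are universally measurable. -/
theorem nullMeasurableSet_of_analyticSet {s : Set α} (hs : AnalyticSet s) (μ : Measure α)
    [IsFiniteMeasure μ] : NullMeasurableSet s μ := by
  rw [AnalyticSet] at hs
  obtain rfl | ⟨g, hg, rfl⟩ := hs
  · exact nullMeasurableSet_empty
  have hbox : ∀ c : {c // c < μ (Set.range g)}, ∃ t ⊆ Set.range g, MeasurableSet t ∧ c.1 ≤ μ t := by
    rintro ⟨c, hc⟩
    obtain ⟨n, hn⟩ := exists_le_measure_image_box hg μ hc
    refine ⟨_, Set.image_subset_range _ _, ?_, hn⟩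
    exact ((isCompact_univ_pi fun i => (Set.finite_Iic (n i)).isCompact).image
      hg).isClosed.measurableSet
  choose t htg htm ht using hbox
  rcases eq_or_ne (μ (Set.range g)) 0 with h0 | h0
  · exact NullMeasurableSet.of_null h0
  -- Inner approximations along thresholds increasing to the full outer measure have a measurable
  -- union that exhausts the set up to a null set.
  obtain ⟨u, -, hu, hlim⟩ := exists_seq_strictMono_tendsto' (pos_iff_ne_zero.2 h0)
  have hle : μ (Set.range g) ≤ μ (⋃ k, t ⟨u k, (hu k).2⟩) :=
    le_of_tendsto' hlim fun k => (ht ⟨u k, (hu k).2⟩).trans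
      (measure_mono (Set.subset_iUnion (fun k => t ⟨u k, (hu k).2⟩) k))
  have hm : MeasurableSet (⋃ k, t ⟨u k, (hu k).2⟩) := MeasurableSet.iUnion fun k => htm _
  exact hm.nullMeasurableSet.congr (ae_eq_of_subset_of_measure_ge
    (Set.iUnion_subset fun k => htg _) hle hm.nullMeasurableSet (measure_ne_top _ _))

end Capacity

/-! ### Kernels evaluated on analytic sets -/

section KernelAnalytic

open scoped ENNReal

variable {P α : Type*} [TopologicalSpace P] [PolishSpace P] [MeasurableSpace P] [BorelSpace P]
  [TopologicalSpace α] [T2Space α] [FirstCountableTopology α] [MeasurableSpace α]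
  [OpensMeasurableSpace α]

/-- The parameters for which a kernel gives an analytic set more than a given mass form an
analytic set. -/
theorem analyticSet_lt_kernel_apply (κ : Kernel P α) [IsFiniteKernel κ] {B : Set α}
    (hB : AnalyticSet B) (c : ℝ≥0∞) : AnalyticSet {p | c < κ p B} := by
  rw [AnalyticSet] at hB
  obtain rfl | ⟨g, hg, rfl⟩ := hB
  · simpa using analyticSet_empty
  -- The sequence `n` witnesses `c < κ p (Set.range g)`: the set in question becomes the projection
  -- of the Borel set where `F` exceeds `c`.
  let F (p : P) (n : ℕ → ℕ) : ℝ≥0∞ := ⨅ j, κ p (closure (g '' boundedPrefix n j))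
  have hF : Measurable fun q : P × (ℕ → ℕ) => F q.1 q.2 := by
    refine Measurable.iInf fun j => ?_
    -- The `j`-th term depends on `n` only through its first `j` entries, which range over a
    -- countable set; the padding by `0` is immaterial.
    let ext (v : Fin j → ℕ) : ℕ → ℕ := fun i => if h : i < j then v ⟨i, h⟩ else 0
    have h1 : Measurable fun q : P × (Fin j → ℕ) =>
        κ q.1 (closure (g '' boundedPrefix (ext q.2) j)) :=
      measurable_from_prod_countable_left fun v => κ.measurable_coe
        (s := closure (g '' boundedPrefix (ext v) j)) isClosed_closure.measurableSet
    have h2 : Measurable fun q : P × (ℕ → ℕ) => (q.1, fun i : Fin j => q.2 i) := by fun_prop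
    convert h1.comp h2 using 1
    funext q
    simp only [Function.comp_apply]
    rw [boundedPrefix_congr]
    intro i hi
    simp [ext, hi]
  have heq : {p | c < κ p (Set.range g)} =
      Prod.fst '' {q : P × (ℕ → ℕ) | c < F q.1 q.2} := by
    ext p
    constructor
    · intro h
      -- An infimum of numbers above `c'` is only known to be at least `c'`, so strictness must be
      -- reserved beforehand.
      obtain ⟨c', hc, hc'⟩ := exists_between (show c < κ p (Set.range g) from h)
      obtain ⟨n, hn⟩ := exists_lt_measure_image_boundedPrefix g (κ p) hc'
      exact ⟨(p, n), hc.trans_le (le_iInf fun j => (hn j).le.trans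
        (measure_mono subset_closure)), rfl⟩
    · rintro ⟨⟨p, n⟩, h, rfl⟩
      have h1 : F p n = κ p (⋂ j, closure (g '' boundedPrefix n j)) :=
        (Antitone.measure_iInter (fun i j hij => closure_mono (Set.image_mono
          (boundedPrefix_anti n hij))) (fun j => isClosed_closure.measurableSet.nullMeasurableSet)
          ⟨0, measure_ne_top _ _⟩).symm
      refine lt_of_lt_of_le h (h1.le.trans (measure_mono ?_))
      rw [iInter_closure_image_boundedPrefix hg]
      exact Set.image_subset_range _ _
  rw [heq]
  exact (measurableSet_lt measurable_const hF).analyticSet.image_of_continuous continuous_fst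

end KernelAnalytic

/-! ### Calculus of upper semianalytic functions -/

section UpperSemianalytic

open scoped ENNReal

variable {α : Type*} [TopologicalSpace α]

/-- Functions whose strict superlevel sets are analytic. -/
def UpperSemianalytic (w : α → ℝ≥0∞) : Prop := ∀ c, AnalyticSet {x | c < w x}

lemma analyticSet_inter [T2Space α] {s t : Set α} (hs : AnalyticSet s) (ht : AnalyticSet t) :
    AnalyticSet (s ∩ t) := by
  rw [Set.inter_eq_iInter]
  exact AnalyticSet.iInter (by rintro (_ | _) <;> assumption)

lemma analyticSet_union {s t : Set α} (hs : AnalyticSet s) (ht : AnalyticSet t) :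
    AnalyticSet (s ∪ t) := by
  rw [Set.union_eq_iUnion]
  exact AnalyticSet.iUnion (by rintro (_ | _) <;> assumption)

lemma Measurable.upperSemianalytic [PolishSpace α] [MeasurableSpace α] [BorelSpace α]
    {w : α → ℝ≥0∞} (hw : Measurable w) : UpperSemianalytic w := fun _ =>
  (measurableSet_lt measurable_const hw).analyticSet

lemma UpperSemianalytic.aemeasurable [T2Space α] [FirstCountableTopology α] [MeasurableSpace α]
    [OpensMeasurableSpace α] {w : α → ℝ≥0∞} (hw : UpperSemianalytic w) (μ : Measure α)
    [IsFiniteMeasure μ] : AEMeasurable w μ := by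
  have : NullMeasurable w μ :=
    measurable_of_Ioi fun c => nullMeasurableSet_of_analyticSet (hw c) μ
  exact this.aemeasurable

/-- A rational `q` with `c - v x < q < u x` separates the two summands. The first two sets of the
decomposition cover the cases in which one summand alone exceeds `c`, where truncated subtraction
would lose strictness. -/
lemma UpperSemianalytic.add [T2Space α] {u v : α → ℝ≥0∞} (hu : UpperSemianalytic u)
    (hv : UpperSemianalytic v) : UpperSemianalytic fun x => u x + v x := by
  intro c
  have heq : {x | c < u x + v x} = {x | c < u x} ∪ {x | c < v x} ∪
      ⋃ q : ℚ, {x | ENNReal.ofReal q < u x} ∩ {x | c - ENNReal.ofReal q < v x} := by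
    ext x
    simp only [Set.mem_union, Set.mem_iUnion, Set.mem_inter_iff, Set.mem_ofPred_eq]
    constructor
    · intro h
      by_cases h1 : c < u x
      · exact Or.inl (Or.inl h1)
      by_cases h2 : c < v x
      · exact Or.inl (Or.inr h2)
      right
      have hvt : v x ≠ ∞ := fun hv => h1.elim (by
        rw [hv] at h2
        have : c = ∞ := by simpa using h2
        exact absurd h (by simp [this]))
      have h3 : c - v x < u x := ENNReal.sub_lt_of_lt_add (not_lt.1 h2) (by simpa using h)
      obtain ⟨q, -, hq1, hq2⟩ := ENNReal.lt_iff_exists_rat_btwn.1 h3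
      have hq1' : c - v x < ENNReal.ofReal q := hq1
      refine ⟨q, hq2, ENNReal.sub_lt_of_lt_add (hq2.le.trans (not_lt.1 h1)) ?_⟩
      have := ENNReal.add_lt_add_right hvt hq1'
      rw [tsub_add_cancel_of_le (not_lt.1 h2)] at this
      rwa [add_comm] at this
    · rintro ((h | h) | ⟨q, h1, h2⟩)
      · exact h.trans_le le_self_add
      · exact h.trans_le le_add_self
      · exact le_add_tsub.trans_lt (ENNReal.add_lt_add h1 h2)
  rw [heq]
  exact analyticSet_union (analyticSet_union (hu c) (hv c))
    (AnalyticSet.iUnion fun q => analyticSet_inter (hu _) (hv _))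

lemma UpperSemianalytic.sum [PolishSpace α] {ι : Type*} (s : Finset ι) {u : ι → α → ℝ≥0∞}
    (hu : ∀ i ∈ s, UpperSemianalytic (u i)) : UpperSemianalytic fun x => ∑ i ∈ s, u i x := by
  classical
  induction s using Finset.induction_on with
  | empty =>
    intro c
    simpa using analyticSet_empty
  | insert i s hi ih =>
    simp only [Finset.sum_insert hi]
    exact (hu i (Finset.mem_insert_self i s)).add
      (ih fun j hj => hu j (Finset.mem_insert_of_mem hj))

lemma UpperSemianalytic.const_mul {u : α → ℝ≥0∞} (hu : UpperSemianalytic u) {a : ℝ≥0∞}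
    (h0 : a ≠ 0) (ht : a ≠ ∞) : UpperSemianalytic fun x => a * u x := by
  intro c
  convert hu (c / a) using 2
  ext x
  rw [ENNReal.div_lt_iff (Or.inl h0) (Or.inl ht), mul_comm]

/-- The number of steps of size `1 / k` strictly below a number of the unit interval. -/
lemma card_filter_div_lt (k : ℕ) {r : ℝ} (h0 : 0 ≤ r) (h1 : r ≤ 1) :
    r * k ≤ ((Finset.range k).filter fun j : ℕ => ((j : ℝ) + 1) < r * k).card + 1 ∧
      (((Finset.range k).filter fun j : ℕ => ((j : ℝ) + 1) < r * k).card : ℝ) ≤ r * k := by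
  have hrk : r * k ≤ k := mul_le_of_le_one_left (Nat.cast_nonneg k) h1
  have hceil : ⌈r * k⌉₊ ≤ k := Nat.ceil_le.2 hrk
  have : (Finset.range k).filter (fun j : ℕ => ((j : ℝ) + 1) < r * k) =
      Finset.range (⌈r * k⌉₊ - 1) := by
    ext j
    have : ((j : ℝ) + 1) < r * k ↔ j + 1 < ⌈r * k⌉₊ := by
      rw [Nat.lt_ceil]; push_cast; rfl
    simp only [Finset.mem_filter, Finset.mem_range, this]
    omega
  rw [this, Finset.card_range]
  have hle := Nat.le_ceil (r * k)
  have hlt := Nat.ceil_lt_add_one (show 0 ≤ r * k by positivity)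
  rcases Nat.eq_zero_or_pos ⌈r * k⌉₊ with hz | hp
  · rw [hz] at hle ⊢
    push_cast at hle ⊢
    constructor
    · simpa using hle.trans zero_le_one
    · simpa using (show 0 ≤ r * k by positivity)
  · rw [Nat.cast_sub hp]
    push_cast
    constructor <;> linarith

open Classical in
/-- Staircase approximation of a function with values in the unit interval. -/
lemma staircase_bounds {x : ℝ≥0∞} (hx : x ≤ 1) (k : ℕ) (hk : 0 < k) :
    (∑ j ∈ Finset.range k, (k : ℝ≥0∞)⁻¹ * if ((j : ℝ≥0∞) + 1) / k < x then 1 else 0) ≤ x ∧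
      x ≤ (∑ j ∈ Finset.range k, (k : ℝ≥0∞)⁻¹ * if ((j : ℝ≥0∞) + 1) / k < x then 1 else 0)
        + (k : ℝ≥0∞)⁻¹ := by
  have hxt : x ≠ ∞ := ne_top_of_le_ne_top ENNReal.one_ne_top hx
  lift x to NNReal using hxt
  have hx1 : (x : ℝ) ≤ 1 := by exact_mod_cast hx
  have hk0 : (k : NNReal) ≠ 0 := by exact_mod_cast hk.ne'
  have hkr : (0 : ℝ) < k := by exact_mod_cast hk
  have hiff : ∀ j : ℕ, ((j : ℝ≥0∞) + 1) / k < (x : ℝ≥0∞) ↔ ((j : ℝ) + 1) < x * k := by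
    intro j
    have : ((j : ℝ≥0∞) + 1) / k = (((j + 1) / k : NNReal) : ℝ≥0∞) := by
      rw [ENNReal.coe_div hk0]; push_cast; rfl
    rw [this, ENNReal.coe_lt_coe, ← NNReal.coe_lt_coe]
    push_cast
    rw [div_lt_iff₀ hkr]
  simp only [hiff]
  have hsum : (∑ j ∈ Finset.range k, (k : ℝ≥0∞)⁻¹ * if ((j : ℝ) + 1) < x * k then 1 else 0) =
      (((((Finset.range k).filter fun j : ℕ => ((j : ℝ) + 1) < x * k).card : NNReal) / k : NNReal)
        : ℝ≥0∞) := by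
    rw [← Finset.mul_sum, Finset.sum_boole, ENNReal.coe_div hk0, mul_comm, div_eq_mul_inv]
    push_cast
    rfl
  obtain ⟨h1, h2⟩ := card_filter_div_lt k x.2 hx1
  have hinv : (k : ℝ≥0∞)⁻¹ = (((k : NNReal)⁻¹ : NNReal) : ℝ≥0∞) := by
    rw [ENNReal.coe_inv hk0]; push_cast; rfl
  rw [hsum, hinv, ← ENNReal.coe_add, ENNReal.coe_le_coe, ENNReal.coe_le_coe,
    ← NNReal.coe_le_coe, ← NNReal.coe_le_coe]
  push_cast
  rw [div_le_iff₀ hkr, ← one_div, ← add_div, le_div_iff₀ hkr]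
  exact ⟨h2, h1⟩

variable {P : Type*} [TopologicalSpace P] [PolishSpace P] [MeasurableSpace P] [BorelSpace P]

open Classical in
/-- Integration against a kernel preserves upper semianalyticity. -/
theorem UpperSemianalytic.lintegral_kernel [T2Space α] [FirstCountableTopology α]
    [MeasurableSpace α] [OpensMeasurableSpace α] {w : α → ℝ≥0∞} (hw : UpperSemianalytic w)
    (hw1 : ∀ x, w x ≤ 1) (κ : Kernel P α) [IsMarkovKernel κ] :
    UpperSemianalytic fun p => ∫⁻ x, w x ∂(κ p) := by
  let B (k j : ℕ) : Set α := {x | ((j : ℝ≥0∞) + 1) / k < w x}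
  -- The integral of the staircase with `k` steps is a finite combination of kernel masses of
  -- analytic sets. It lies below the integral of `w` and within `1 / k` of it, so superlevel sets
  -- of the integral are countable unions.
  let I (k : ℕ) (p : P) : ℝ≥0∞ := ∑ j ∈ Finset.range k, (k : ℝ≥0∞)⁻¹ * κ p (B k j)
  have hI : ∀ k > 0, ∀ p, ∫⁻ x, (∑ j ∈ Finset.range k,
      (k : ℝ≥0∞)⁻¹ * if ((j : ℝ≥0∞) + 1) / k < w x then 1 else 0) ∂(κ p) = I k p := by
    intro k hk p
    have hB : ∀ j : ℕ, NullMeasurableSet (B k j) (κ p) := fun j =>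
      nullMeasurableSet_of_analyticSet (hw _) _
    have hind : ∀ j : ℕ, (fun x => if ((j : ℝ≥0∞) + 1) / k < w x then (1 : ℝ≥0∞) else 0) =
        (B k j).indicator 1 := fun j => by
      funext x; simp [B, Set.indicator_apply]
    have hm : ∀ j : ℕ, AEMeasurable (fun x => if ((j : ℝ≥0∞) + 1) / k < w x then (1 : ℝ≥0∞) else 0)
        (κ p) := fun j => by
      rw [hind]
      exact aemeasurable_const.indicator₀ (hB j)
    rw [lintegral_finsetSum' _ fun j _ => (hm j).const_mul _]
    refine Finset.sum_congr rfl fun j _ => ?_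
    rw [lintegral_const_mul'' _ (hm j), hind, lintegral_indicator_one₀ (hB j)]
  have husa : ∀ k > 0, UpperSemianalytic (I k) := fun k hk =>
    UpperSemianalytic.sum _ fun j _ => UpperSemianalytic.const_mul
      (fun c => analyticSet_lt_kernel_apply κ (hw _) c) (by simp) (by simpa using hk.ne')
  intro c
  have heq : {p | c < ∫⁻ x, w x ∂(κ p)} = ⋃ k : ℕ, {p | c < I (k + 1) p} := by
    ext p
    simp only [Set.mem_iUnion, Set.mem_ofPred_eq]
    constructor
    · intro h
      obtain ⟨d, hd0, hd⟩ := ENNReal.lt_iff_exists_add_pos_lt.1 h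
      obtain ⟨k, hk⟩ := ENNReal.exists_inv_nat_lt (a := (d : ℝ≥0∞)) (by simpa using hd0.ne')
      have hk' : ((k + 1 : ℕ) : ℝ≥0∞)⁻¹ ≤ (d : ℝ≥0∞) :=
        (ENNReal.inv_le_inv.2 (by exact_mod_cast k.le_succ)).trans hk.le
      refine ⟨k, ?_⟩
      have h1 : ∫⁻ x, w x ∂(κ p) ≤ I (k + 1) p + ((k + 1 : ℕ) : ℝ≥0∞)⁻¹ := by
        rw [← hI (k + 1) k.succ_pos]
        refine (lintegral_mono fun x => (staircase_bounds (hw1 x) (k + 1) k.succ_pos).2).trans ?_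
        rw [lintegral_add_right _ measurable_const]
        simp
      have h2 : c + d < I (k + 1) p + d :=
        hd.trans_le (h1.trans (by gcongr))
      exact lt_of_add_lt_add_right h2
    · rintro ⟨k, hk⟩
      refine hk.trans_le ?_
      rw [← hI (k + 1) k.succ_pos]
      exact lintegral_mono fun x => (staircase_bounds (hw1 x) (k + 1) k.succ_pos).1
  rw [heq]
  exact AnalyticSet.iUnion fun k => husa (k + 1) k.succ_pos c

end UpperSemianalytic

/-! ### Measurable choice of actions -/

section Selectors

open scoped ENNReal

variable {S A : Type*} [MetricSpace S] [MeasurableSpace S]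
  [MetricSpace A] [CompactSpace A] [MeasurableSpace A] [BorelSpace A]

open TopologicalSpace in
/-- The set of all state-action pairs is measurable. -/
lemma measurableSet_pairs (M : MDP S A) : MeasurableSet {p : S × A | p.2 ∈ M.av p.1} := by
  rcases isEmpty_or_nonempty A with hA | hA
  · exact MeasurableSet.congr MeasurableSet.empty
      (Set.eq_empty_of_forall_notMem fun p _ => hA.elim p.2).symm
  have heq : {p : S × A | p.2 ∈ M.av p.1} = ⋂ k : ℕ, ⋃ i : ℕ,
      {s | (M.av s ∩ Metric.ball (denseSeq A i) (1 / ((k : ℝ) + 1))).Nonempty} ×ˢ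
        Metric.ball (denseSeq A i) (1 / ((k : ℝ) + 1)) := by
    ext ⟨s, a⟩
    simp only [Set.mem_iInter, Set.mem_iUnion, Set.mem_prod, Set.mem_ofPred_eq]
    constructor
    · intro h k
      obtain ⟨i, hi⟩ := (denseRange_denseSeq A).exists_dist_lt a
        (show (0 : ℝ) < 1 / ((k : ℝ) + 1) by positivity)
      exact ⟨i, ⟨a, h, hi⟩, hi⟩
    · intro h
      rw [← (M.av_compact s).isClosed.closure_eq, Metric.mem_closure_iff]
      intro ε hε
      obtain ⟨k, hk⟩ := exists_nat_one_div_lt (half_pos hε)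
      obtain ⟨i, ⟨b, hb, hbi⟩, hai⟩ := h k
      refine ⟨b, hb, ?_⟩
      rw [Metric.mem_ball] at hai hbi
      have := dist_triangle_right a b (denseSeq A i)
      linarith
  rw [heq]
  exact MeasurableSet.iInter fun k => MeasurableSet.iUnion fun i =>
    (M.hit_measurable _ Metric.isOpen_ball).prod Metric.isOpen_ball.measurableSet

lemma exists_measurable_selector (M : MDP S A) :
    ∃ f : S → A, Measurable f ∧ ∀ s, f s ∈ M.av s := by
  rcases isEmpty_or_nonempty S with hS | ⟨⟨s₁⟩⟩
  · exact ⟨fun s => hS.elim s, measurable_of_empty _, fun s => hS.elim s⟩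
  have : Nonempty A := ⟨(M.av_nonempty s₁).some⟩
  exact exists_measurable_selection M.av M.av_nonempty
    (fun s => (M.av_compact s).isClosed) M.hit_measurable

variable [BorelSpace S]

/-- An everywhere available measurable choice of actions that follows a compact set of
state-action pairs. -/
lemma exists_measurable_selector_of_isCompact (M : MDP S A) {K : Set (S × A)} (hK : IsCompact K)
    (hsub : ∀ p ∈ K, p.2 ∈ M.av p.1) :
    ∃ f : S → A, Measurable f ∧ (∀ s, f s ∈ M.av s) ∧ ∀ s ∈ Prod.fst '' K, (s, f s) ∈ K := by
  classical
  rcases isEmpty_or_nonempty S with hS | ⟨⟨s₁⟩⟩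
  · exact ⟨fun s => hS.elim s, measurable_of_empty _, fun s => hS.elim s, fun s => hS.elim s⟩
  have : Nonempty A := ⟨(M.av_nonempty s₁).some⟩
  have hC : MeasurableSet (Prod.fst '' K) := (hK.image continuous_fst).measurableSet
  -- For closed `F` this is the projection of a compact set, hence closed; an open set is a
  -- countable union of closed ones.
  have hhit : ∀ F : Set A, IsClosed F → MeasurableSet {s | ({a | (s, a) ∈ K} ∩ F).Nonempty} := by
    intro F hF
    convert ((hK.inter_right (hF.preimage continuous_snd)).image continuous_fst).measurableSet
    ext s
    constructor
    · rintro ⟨a, ha, haF⟩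
      exact ⟨(s, a), ⟨ha, haF⟩, rfl⟩
    · rintro ⟨⟨s, a⟩, ⟨ha, haF⟩, rfl⟩
      exact ⟨a, ha, haF⟩
  have hhit' : ∀ U : Set A, IsOpen U → MeasurableSet {s | ({a | (s, a) ∈ K} ∩ U).Nonempty} := by
    intro U hU
    obtain ⟨F, hF, -, hFU, -⟩ := hU.exists_iUnion_isClosed
    rw [← hFU]
    simp only [Set.inter_iUnion, Set.nonempty_iUnion, Set.ofPred_exists]
    exact MeasurableSet.iUnion fun n => hhit _ (hF n)
  let Φ (s : S) : Set A := if s ∈ Prod.fst '' K then {a | (s, a) ∈ K} else M.av s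
  have hΦne : ∀ s, (Φ s).Nonempty := fun s => by
    dsimp only [Φ]
    split_ifs with h
    · obtain ⟨⟨s, a⟩, ha, rfl⟩ := h
      exact ⟨a, ha⟩
    · exact M.av_nonempty s
  have hΦcl : ∀ s, IsClosed (Φ s) := fun s => by
    dsimp only [Φ]
    split_ifs with h
    · exact hK.isClosed.preimage (by fun_prop : Continuous fun a => (s, a))
    · exact (M.av_compact s).isClosed
  have hΦm : ∀ U : Set A, IsOpen U → MeasurableSet {s | (Φ s ∩ U).Nonempty} := fun U hU => by
    have : {s | (Φ s ∩ U).Nonempty} =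
        {s | ({a | (s, a) ∈ K} ∩ U).Nonempty} ∪
          ((Prod.fst '' K)ᶜ ∩ {s | (M.av s ∩ U).Nonempty}) := by
      ext s
      by_cases h : s ∈ Prod.fst '' K
      · simp only [Φ, if_true, Set.mem_union, Set.mem_inter_iff, Set.mem_compl_iff, h, not_true,
          false_and, or_false, Set.mem_ofPred_eq]
      · have h' : ¬ ({a | (s, a) ∈ K} ∩ U).Nonempty := fun ⟨a, ha, _⟩ => h ⟨_, ha, rfl⟩
        simp only [Φ, if_false, Set.mem_union, Set.mem_inter_iff, Set.mem_compl_iff, h,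
          not_false_eq_true, true_and, Set.mem_ofPred_eq, h', false_or]
    rw [this]
    exact (hhit' U hU).union (hC.compl.inter (M.hit_measurable U hU))
  obtain ⟨f, hfm, hf⟩ := exists_measurable_selection Φ hΦne hΦcl hΦm
  refine ⟨f, hfm, fun s => ?_, fun s hs => ?_⟩
  · have := hf s
    dsimp only [Φ] at this
    split_ifs at this
    · exact hsub _ this
    · exact this
  · have := hf s
    dsimp only [Φ] at this
    rwa [if_pos hs] at this

/-- Measurable selection from an analytic set of state-action pairs, up to a small set. -/
theorem exists_measurable_selector_of_analyticSet (M : MDP S A) {G : Set (S × A)}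
    (hG : AnalyticSet G) (hsub : ∀ p ∈ G, p.2 ∈ M.av p.1) (μ : Measure S) [IsFiniteMeasure μ]
    {ε : ℝ≥0∞} (hε : ε ≠ 0) :
    ∃ f : S → A, Measurable f ∧ (∀ s, f s ∈ M.av s) ∧ ∃ N, MeasurableSet N ∧ μ N ≤ ε ∧
      ∀ s ∉ N, s ∈ Prod.fst '' G → (s, f s) ∈ G := by
  by_cases hle : μ (Prod.fst '' G) ≤ ε
  · obtain ⟨f, hfm, hf⟩ := exists_measurable_selector M
    exact ⟨f, hfm, hf, _, measurableSet_toMeasurable μ (Prod.fst '' G),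
      (measure_toMeasurable _).trans_le hle,
      fun s hs hsG => absurd (subset_toMeasurable _ _ hsG) hs⟩
  rw [AnalyticSet] at hG
  obtain rfl | ⟨g, hg, rfl⟩ := hG
  · simp at hle
  rw [not_le] at hle
  -- Capacitability is applied to the projection, but the box gives a compact subset of the set of
  -- pairs itself, whose projection misses mass at most `ε`.
  have hlt : μ (Prod.fst '' Set.range g) - ε < μ (Set.range (Prod.fst ∘ g)) := by
    rw [Set.range_comp]
    exact ENNReal.sub_lt_self (measure_ne_top _ _) hle.ne_bot hε
  obtain ⟨n, hn⟩ := exists_le_measure_image_box (continuous_fst.comp hg) μ hlt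
  have hKc : IsCompact (g '' Set.univ.pi fun i => Set.Iic (n i)) :=
    (isCompact_univ_pi fun i => (Set.finite_Iic (n i)).isCompact).image hg
  rw [Set.image_comp] at hn
  obtain ⟨f, hfm, hf, hfK⟩ := exists_measurable_selector_of_isCompact M hKc
    fun p hp => hsub p (Set.image_subset_range _ _ hp)
  have hC := (hKc.image continuous_fst).measurableSet
  refine ⟨f, hfm, hf, toMeasurable μ (Prod.fst '' Set.range g) \ _,
    (measurableSet_toMeasurable _ _).diff hC, ?_, fun s hs hsG => ?_⟩
  · rw [measure_sdiff ((Set.image_mono (Set.image_subset_range _ _)).trans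
      (subset_toMeasurable _ _)) hC.nullMeasurableSet (measure_ne_top _ _), measure_toMeasurable]
    rw [tsub_le_iff_left] at hn ⊢
    rwa [add_comm]
  · by_contra hnot
    exact hs ⟨subset_toMeasurable _ _ hsG, fun hsK =>
      hnot (Set.image_subset_range _ _ (hfK s hsK))⟩

end Selectors

/-! ### Finite-horizon values and policies -/

section Horizon

open scoped ENNReal

variable {S A : Type*} [TopologicalSpace S] [MeasurableSpace S]
  [TopologicalSpace A] [MeasurableSpace A]

open Classical in
/-- The optimal probability of visiting `T` within `k` steps after taking a given action. -/
def MDP.horizonPairValue (M : MDP S A) (T : Set S) : ℕ → S × A → ℝ≥0∞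
  | 0, p => if p.1 ∈ T then 1 else 0
  | k + 1, p => if p.1 ∈ T then 1 else
      ∫⁻ s, (⨆ a ∈ M.av s, M.horizonPairValue T k (s, a)) ∂(M.trans p)

/-- The optimal probability of visiting `T` within `k` steps. -/
def MDP.horizonValue (M : MDP S A) (T : Set S) (k : ℕ) (s : S) : ℝ≥0∞ :=
  ⨆ a ∈ M.av s, M.horizonPairValue T k (s, a)

open Classical in
/-- The probability of visiting `T` within `k` steps under a time-dependent choice of actions. -/
def MDP.policyValue (M : MDP S A) (T : Set S) : ℕ → (ℕ → S → A) → S → ℝ≥0∞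
  | 0, _, s => if s ∈ T then 1 else 0
  | k + 1, f, s => if s ∈ T then 1 else
      ∫⁻ s', M.policyValue T k (fun i => f (i + 1)) s' ∂(M.trans (s, f 0 s))

variable {M : MDP S A} {T : Set S}

lemma horizonPairValue_of_mem {k : ℕ} {p : S × A} (h : p.1 ∈ T) : M.horizonPairValue T k p = 1 := by
  cases k <;> simp [MDP.horizonPairValue, h]

lemma horizonPairValue_zero_of_notMem {p : S × A} (h : p.1 ∉ T) :
    M.horizonPairValue T 0 p = 0 := by
  simp [MDP.horizonPairValue, h]

lemma horizonPairValue_succ_of_notMem {k : ℕ} {p : S × A} (h : p.1 ∉ T) :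
    M.horizonPairValue T (k + 1) p = ∫⁻ s, M.horizonValue T k s ∂(M.trans p) := by
  simp [MDP.horizonPairValue, h, MDP.horizonValue]

lemma horizonPairValue_le_horizonValue {k : ℕ} {s : S} {a : A} (ha : a ∈ M.av s) :
    M.horizonPairValue T k (s, a) ≤ M.horizonValue T k s :=
  le_iSup₂ (f := fun a _ => M.horizonPairValue T k (s, a)) a ha

lemma horizonPairValue_le_one (k : ℕ) (p : S × A) : M.horizonPairValue T k p ≤ 1 := by
  induction k generalizing p with
  | zero =>
    by_cases h : p.1 ∈ T
    · exact (horizonPairValue_of_mem h).le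
    · exact (horizonPairValue_zero_of_notMem h).trans_le zero_le_one
  | succ k ih =>
    by_cases h : p.1 ∈ T
    · exact (horizonPairValue_of_mem h).le
    · rw [horizonPairValue_succ_of_notMem h]
      refine (lintegral_mono (g := 1) fun s => iSup₂_le fun a _ => ih (s, a)).trans ?_
      simp

lemma horizonValue_le_one (k : ℕ) (s : S) : M.horizonValue T k s ≤ 1 :=
  iSup₂_le fun _ _ => horizonPairValue_le_one k _

lemma horizonPairValue_mono_succ (k : ℕ) (p : S × A) :
    M.horizonPairValue T k p ≤ M.horizonPairValue T (k + 1) p := by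
  induction k generalizing p with
  | zero =>
    by_cases h : p.1 ∈ T
    · rw [horizonPairValue_of_mem h, horizonPairValue_of_mem h]
    · rw [horizonPairValue_zero_of_notMem h]; exact zero_le
  | succ k ih =>
    by_cases h : p.1 ∈ T
    · rw [horizonPairValue_of_mem h, horizonPairValue_of_mem h]
    · rw [horizonPairValue_succ_of_notMem h, horizonPairValue_succ_of_notMem h]
      exact lintegral_mono fun s => iSup₂_mono fun a _ => ih (s, a)

lemma horizonValue_mono (s : S) : Monotone fun k => M.horizonValue T k s :=
  monotone_nat_of_le_succ fun k => iSup₂_mono fun a _ => horizonPairValue_mono_succ k (s, a)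

lemma policyValue_of_mem {k : ℕ} {f : ℕ → S → A} {s : S} (h : s ∈ T) :
    M.policyValue T k f s = 1 := by
  cases k <;> simp [MDP.policyValue, h]

lemma policyValue_zero_of_notMem {f : ℕ → S → A} {s : S} (h : s ∉ T) :
    M.policyValue T 0 f s = 0 := by
  simp [MDP.policyValue, h]

lemma policyValue_succ_of_notMem {k : ℕ} {f : ℕ → S → A} {s : S} (h : s ∉ T) :
    M.policyValue T (k + 1) f s =
      ∫⁻ s', M.policyValue T k (fun i => f (i + 1)) s' ∂(M.trans (s, f 0 s)) := by
  simp [MDP.policyValue, h]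

lemma measurable_policyValue (hT : MeasurableSet T) (k : ℕ) (f : ℕ → S → A)
    (hf : ∀ i, Measurable (f i)) : Measurable (M.policyValue T k f) := by
  induction k generalizing f with
  | zero => exact Measurable.ite hT measurable_const measurable_const
  | succ k ih =>
    refine Measurable.ite hT measurable_const ?_
    exact ((ih (fun i => f (i + 1)) fun i => hf (i + 1)).lintegral_kernel (κ := M.trans)).comp
      (measurable_id.prodMk (hf 0))

end Horizon

/-! ### Near-optimal measurable policies -/

section Semianalytic

open scoped ENNReal

variable {S A : Type*} [MetricSpace S] [CompactSpace S] [MeasurableSpace S] [BorelSpace S]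
  [MetricSpace A] [CompactSpace A] [MeasurableSpace A] [BorelSpace A] {M : MDP S A} {T : Set S}

/-- A supremum exceeds `c` strictly exactly when some available action does, so superlevel sets are
projections of analytic sets. -/
lemma UpperSemianalytic.horizonValue {k : ℕ} (h : UpperSemianalytic (M.horizonPairValue T k)) :
    UpperSemianalytic (M.horizonValue T k) := by
  intro c
  have heq : {s | c < M.horizonValue T k s} =
      Prod.fst '' ({p : S × A | p.2 ∈ M.av p.1} ∩ {p | c < M.horizonPairValue T k p}) := by
    ext s
    simp only [MDP.horizonValue, Set.mem_ofPred_eq, lt_iSup_iff, Set.mem_image, Set.mem_inter_iff,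
      Prod.exists, exists_and_right, exists_eq_right]
    exact exists_congr fun a => by simp
  rw [heq]
  exact (analyticSet_inter (measurableSet_pairs M).analyticSet (h c)).image_of_continuous
    continuous_fst

lemma upperSemianalytic_horizonPairValue (hT : MeasurableSet T) (k : ℕ) :
    UpperSemianalytic (M.horizonPairValue T k) := by
  have hT' : MeasurableSet {p : S × A | p.1 ∈ T} := measurable_fst hT
  induction k with
  | zero => exact Measurable.upperSemianalytic (.ite hT' measurable_const measurable_const)
  | succ k ih =>
    intro c
    have h1 := ih.horizonValue.lintegral_kernel (horizonValue_le_one k) M.trans c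
    have heq : {p | c < M.horizonPairValue T (k + 1) p} =
        ({p | p.1 ∈ T} ∩ {_p | c < 1}) ∪
          ({p | p.1 ∈ T}ᶜ ∩ {p | c < ∫⁻ s, M.horizonValue T k s ∂(M.trans p)}) := by
      ext p
      by_cases h : p.1 ∈ T
      · simp [horizonPairValue_of_mem h, h]
      · simp [horizonPairValue_succ_of_notMem h, h]
    rw [heq]
    exact analyticSet_union (hT'.inter (MeasurableSet.const _)).analyticSet
      (analyticSet_inter hT'.compl.analyticSet h1)

lemma upperSemianalytic_horizonValue (hT : MeasurableSet T) (k : ℕ) :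
    UpperSemianalytic (M.horizonValue T k) :=
  (upperSemianalytic_horizonPairValue hT k).horizonValue

/-- One step of near-optimal measurable control. -/
lemma exists_nearly_optimal_selector (hT : MeasurableSet T) (k : ℕ) (μ : Measure S)
    [IsFiniteMeasure μ] {δ : ℝ≥0∞} (hδ : δ ≠ 0) :
    ∃ f : S → A, Measurable f ∧ (∀ s, f s ∈ M.av s) ∧
      ∫⁻ s in Tᶜ, M.horizonValue T (k + 1) s ∂μ ≤
        ∫⁻ s in Tᶜ, ∫⁻ s', M.horizonValue T k s' ∂(M.trans (s, f s)) ∂μ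
          + (δ * μ Set.univ + δ) := by
  let U (p : S × A) : ℝ≥0∞ := ∫⁻ s, M.horizonValue T k s ∂(M.trans p)
  have hU : UpperSemianalytic U :=
    (upperSemianalytic_horizonValue hT k).lintegral_kernel (horizonValue_le_one k) M.trans
  -- Replacing the optimal value by an almost everywhere equal Borel function `w` keeps `G`
  -- analytic: an upper bound on a semianalytic function would be a co-analytic condition.
  obtain ⟨w, hw, hWw⟩ := (upperSemianalytic_horizonValue (M := M) hT (k + 1)).aemeasurable μ
  let G : Set (S × A) := {p | p.2 ∈ M.av p.1} ∩ {p | w p.1 - δ < U p}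
  have hG : AnalyticSet G := by
    refine analyticSet_inter (measurableSet_pairs M).analyticSet ?_
    have heq : {p : S × A | w p.1 - δ < U p} =
        ⋃ q : ℚ, {p | w p.1 - δ < ENNReal.ofReal q} ∩ {p | ENNReal.ofReal q < U p} := by
      ext p
      simp only [Set.mem_ofPred_eq, Set.mem_iUnion, Set.mem_inter_iff]
      constructor
      · intro h
        obtain ⟨q, -, h1, h2⟩ := ENNReal.lt_iff_exists_rat_btwn.1 h
        exact ⟨q, h1, h2⟩
      · rintro ⟨q, h1, h2⟩
        exact h1.trans h2
    rw [heq]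
    exact AnalyticSet.iUnion fun q => analyticSet_inter
      (measurableSet_lt ((hw.comp measurable_fst).sub measurable_const)
        measurable_const).analyticSet (hU _)
  obtain ⟨f, hfm, hf, N, hN, hμN, hfG⟩ := exists_measurable_selector_of_analyticSet M hG
    (fun p hp => hp.1) μ hδ
  refine ⟨f, hfm, hf, ?_⟩
  have hpt : ∀ᵐ s ∂(μ.restrict Tᶜ), M.horizonValue T (k + 1) s ≤
      U (s, f s) + (δ + N.indicator 1 s) := by
    filter_upwards [ae_restrict_mem hT.compl, ae_restrict_of_ae hWw] with s hsT hsw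
    by_cases hsN : s ∈ N
    -- On the exceptional set, of measure at most `δ`, the trivial bound `1` is paid for by the
    -- indicator.
    · refine (horizonValue_le_one _ _).trans ?_
      rw [Set.indicator_of_mem hsN]
      exact le_add_self.trans le_add_self
    rw [Set.indicator_of_notMem hsN, add_zero]
    by_cases hsG : s ∈ Prod.fst '' G
    · rw [hsw]
      exact tsub_le_iff_right.1 (hfG s hsN hsG).2.le
    -- If no action comes within `δ` of the optimum, then the optimum is at most itself minus `δ`,
    -- which for truncated subtraction forces it to vanish.
    · have hle : M.horizonValue T (k + 1) s ≤ M.horizonValue T (k + 1) s - δ := by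
        refine iSup₂_le fun a ha => ?_
        rw [horizonPairValue_succ_of_notMem (p := (s, a)) hsT, hsw]
        by_contra hlt
        exact hsG ⟨(s, a), ⟨ha, not_le.1 hlt⟩, rfl⟩
      have h0 : M.horizonValue T (k + 1) s = 0 := by
        by_contra h0
        exact absurd hle (not_le.2 (ENNReal.sub_lt_self
          (ne_top_of_le_ne_top ENNReal.one_ne_top (horizonValue_le_one _ _)) h0 hδ))
      rw [h0]
      exact zero_le
  refine (lintegral_mono_ae hpt).trans ?_
  have hm : Measurable fun s => δ + N.indicator (1 : S → ℝ≥0∞) s :=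
    measurable_const.add (measurable_one.indicator hN)
  rw [lintegral_add_right _ hm,
    lintegral_add_left measurable_const, lintegral_const, lintegral_indicator_one hN]
  gcongr
  · exact Measure.restrict_le_self
  · exact (Measure.restrict_le_self _).trans hμN

/-- Near-optimal measurable control over a finite horizon. -/
theorem exists_nearly_optimal_policy (hT : MeasurableSet T) (k : ℕ) (μ : Measure S)
    [IsFiniteMeasure μ] {ε : ℝ≥0∞} (hε : ε ≠ 0) :
    ∃ f : ℕ → S → A, (∀ i, Measurable (f i)) ∧ (∀ i s, f i s ∈ M.av s) ∧
      ∫⁻ s, M.horizonValue T k s ∂μ ≤ ∫⁻ s, M.policyValue T k f s ∂μ + ε := by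
  induction k generalizing μ ε with
  | zero =>
    obtain ⟨f, hfm, hf⟩ := exists_measurable_selector M
    refine ⟨fun _ => f, fun _ => hfm, fun _ => hf, le_add_right (lintegral_mono fun s => ?_)⟩
    refine iSup₂_le fun a _ => ?_
    by_cases h : s ∈ T
    · rw [horizonPairValue_of_mem h, policyValue_of_mem h]
    · rw [horizonPairValue_zero_of_notMem h]; exact zero_le
  | succ k ih =>
    -- One step loses `δ * μ univ + δ`; this `δ` keeps the loss within `ε / 2`.
    have hδ : ε / 2 / (μ Set.univ + 1) ≠ 0 := by
      refine (ENNReal.div_pos ?_ (by finiteness)).ne'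
      simpa using hε
    obtain ⟨f₀, hf₀m, hf₀, hstep⟩ := exists_nearly_optimal_selector (M := M) hT k μ hδ
    let κ : Kernel S S := M.trans.comap (fun s => (s, f₀ s)) (measurable_id.prodMk hf₀m)
    -- The remaining policy is chosen for the law of the successor of a non-target state under `f₀`;
    -- this is why the induction runs over all finite measures.
    obtain ⟨f, hfm, hf, hle⟩ := ih ((μ.restrict Tᶜ).bind κ) (ε := ε / 2) (by simpa using hε)
    refine ⟨fun i => Nat.casesOn i f₀ f, ?_, ?_, ?_⟩
    · rintro (_ | i)
      exacts [hf₀m, hfm i]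
    · rintro (_ | i)
      exacts [hf₀, hf i]
    rw [Measure.lintegral_bind κ.aemeasurable
      ((upperSemianalytic_horizonValue hT k).aemeasurable _),
      Measure.lintegral_bind κ.aemeasurable (measurable_policyValue hT k f hfm).aemeasurable] at hle
    rw [← lintegral_add_compl _ hT, ← lintegral_add_compl (fun s => M.policyValue T _ _ s) hT,
      add_assoc]
    refine add_le_add (setLIntegral_mono' hT fun s hs => ?_) ?_
    · rw [policyValue_of_mem hs]
      exact horizonValue_le_one _ _
    have hpol : ∫⁻ s in Tᶜ, M.policyValue T (k + 1) (fun i => Nat.casesOn i f₀ f) s ∂μ =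
        ∫⁻ s in Tᶜ, ∫⁻ s', M.policyValue T k f s' ∂(κ s) ∂μ :=
      setLIntegral_congr_fun hT.compl fun s hs => policyValue_succ_of_notMem hs
    rw [hpol]
    refine hstep.trans ?_
    have hsmall : ε / 2 / (μ Set.univ + 1) * μ Set.univ + ε / 2 / (μ Set.univ + 1) ≤ ε / 2 := by
      rw [← mul_add_one, mul_comm]
      exact ENNReal.mul_div_le
    refine (add_le_add hle hsmall).trans ?_
    rw [add_assoc, ENNReal.add_halves]

end Semianalytic

/-! ### One-step recursion for trajectory kernels -/

section Trajectories

open scoped ENNReal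

variable {S A : Type*}

/-- Appending a state-action pair to a history of pairs. -/
def extendHist (n : ℕ) (x : Finset.Iic n → S × A) (y : S × A) : Finset.Iic (n + 1) → S × A :=
  fun i => if h : i.1 ≤ n then x ⟨i.1, Finset.mem_Iic.2 h⟩ else y

lemma extendHist_of_le {n : ℕ} (x : Finset.Iic n → S × A) (y : S × A) {i : ℕ} (h : i ≤ n)
    (hi : i ∈ Finset.Iic (n + 1)) : extendHist n x y ⟨i, hi⟩ = x ⟨i, Finset.mem_Iic.2 h⟩ := by
  simp [extendHist, h]

@[simp]
lemma lastPair_extendHist (n : ℕ) (x : Finset.Iic n → S × A) (y : S × A) :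
    lastPair (n + 1) (extendHist n x y) = y := by
  simp [lastPair, extendHist]

/-- The paths that visit `T` at a time between `n` and `n + m`. -/
def visits (A : Type*) (T : Set S) (n m : ℕ) : Set (ℕ → S × A) :=
  {ρ | ∃ i, n ≤ i ∧ i ≤ n + m ∧ (ρ i).1 ∈ T}

lemma visits_zero (T : Set S) (n : ℕ) : visits A T n 0 = {ρ | (ρ n).1 ∈ T} := by
  ext ρ
  constructor
  · rintro ⟨i, h1, h2, h3⟩
    obtain rfl : i = n := le_antisymm h2 h1
    exact h3
  · exact fun h => ⟨n, le_rfl, le_rfl, h⟩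

lemma visits_succ (T : Set S) (n m : ℕ) :
    visits A T n (m + 1) = {ρ | (ρ n).1 ∈ T} ∪ visits A T (n + 1) m := by
  ext ρ
  constructor
  · rintro ⟨i, h1, h2, h3⟩
    rcases h1.eq_or_lt with rfl | h
    · exact Or.inl h3
    · exact Or.inr ⟨i, h, by omega, h3⟩
  · rintro (h | ⟨i, h1, h2, h3⟩)
    · exact ⟨n, le_rfl, by omega, h⟩
    · exact ⟨i, by omega, by omega, h3⟩

lemma eventually_eq_iUnion_visits (T : Set S) : eventually A T = ⋃ m, visits A T 0 m := by
  ext ρ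
  simp only [eventually, visits, Set.mem_iUnion, Set.mem_ofPred_eq]
  exact ⟨fun ⟨i, h⟩ => ⟨i, i, Nat.zero_le _, by omega, h⟩, fun ⟨_, i, _, _, h⟩ => ⟨i, h⟩⟩

lemma visits_mono (T : Set S) (n : ℕ) : Monotone (visits A T n) :=
  fun _ _ hab _ ⟨i, h1, h2, h3⟩ => ⟨i, h1, h2.trans (Nat.add_le_add_left hab n), h3⟩

variable [MeasurableSpace S] [MeasurableSpace A]

lemma measurable_extendHist (n : ℕ) (x : Finset.Iic n → S × A) : Measurable (extendHist n x) := by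
  refine measurable_pi_lambda _ fun i => ?_
  by_cases h : i.1 ≤ n
  · simp only [extendHist, h, dif_pos, measurable_const]
  · simp only [extendHist, h, dif_neg, not_false_eq_true]
    exact measurable_id

lemma measurableSet_visit {T : Set S} (hT : MeasurableSet T) (i : ℕ) :
    MeasurableSet {ρ : ℕ → S × A | (ρ i).1 ∈ T} :=
  (measurable_fst.comp (measurable_pi_apply i)) hT

lemma measurableSet_visits {T : Set S} (hT : MeasurableSet T) (n m : ℕ) :
    MeasurableSet (visits A T n m) := by
  induction m generalizing n with
  | zero => rw [visits_zero]; exact measurableSet_visit hT n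
  | succ m ih => rw [visits_succ]; exact (measurableSet_visit hT n).union (ih (n + 1))

variable (κ : ∀ n : ℕ, Kernel (Finset.Iic n → S × A) (S × A)) [∀ n, IsMarkovKernel (κ n)]

lemma partialTraj_succ_self_apply (n : ℕ) (x : Finset.Iic n → S × A) :
    Kernel.partialTraj (X := fun _ => S × A) κ n (n + 1) x = (κ n x).map (extendHist n x) := by
  have hcomp : extendHist n x = IicProdIoc (X := fun _ => S × A) n (n + 1) ∘ Prod.mk x ∘
      MeasurableEquiv.piSingleton (X := fun _ => S × A) n := by
    funext y i
    simp [extendHist, IicProdIoc, MeasurableEquiv.piSingleton]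
  rw [Kernel.partialTraj_succ_self]
  refine (Kernel.map_apply _ measurable_IicProdIoc x).trans ?_
  rw [Kernel.prod_apply, Kernel.id_apply, Kernel.map_apply _ (MeasurableEquiv.measurable _), hcomp,
    Measure.dirac_prod, Measure.map_map measurable_prodMk_left (MeasurableEquiv.measurable _)]
  exact Measure.map_map measurable_IicProdIoc
    (measurable_prodMk_left.comp (MeasurableEquiv.measurable _))

/-- Conditioning on the next pair: the trajectory kernel from time `n` is one step followed by the
trajectory kernel from time `n + 1`. -/
lemma traj_apply_eq_lintegral_succ (n : ℕ) (x : Finset.Iic n → S × A) {E : Set (ℕ → S × A)}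
    (hE : MeasurableSet E) :
    Kernel.traj (X := fun _ => S × A) κ n x E =
      ∫⁻ y, Kernel.traj (X := fun _ => S × A) κ (n + 1) (extendHist n x y) E ∂(κ n x) := by
  have h := Kernel.traj_comp_partialTraj (X := fun _ => S × A) (κ := κ) n.le_succ
  refine (congrArg (fun η : Kernel _ _ => η x E) h).symm.trans ?_
  rw [Kernel.comp_apply' _ _ _ hE, partialTraj_succ_self_apply,
    lintegral_map (Kernel.measurable_coe _ hE) (measurable_extendHist n x)]

/-- Trajectories leave the given history unchanged, so a visit at time `n` is a deterministic event.
-/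
lemma traj_preimage_fst_apply (n : ℕ) (x : Finset.Iic n → S × A) {T : Set S}
    (hT : MeasurableSet T) :
    Kernel.traj (X := fun _ => S × A) κ n x {ρ | (ρ n).1 ∈ T} =
      T.indicator 1 (lastPair n x).1 := by
  rw [← Kernel.traj_map_updateFinset, Measure.map_apply measurable_updateFinset_left
    (measurableSet_visit hT n)]
  have h : ∀ ρ : ℕ → S × A, Function.updateFinset ρ (Finset.Iic n) x n = lastPair n x := fun ρ => by
    simp [Function.updateFinset, lastPair]
  by_cases hx : (lastPair n x).1 ∈ T
  · simp [h, hx, Set.preimage]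
  · simp [h, hx, Set.preimage]

lemma traj_visits_of_mem (n m : ℕ) (x : Finset.Iic n → S × A) {T : Set S}
    (hT : MeasurableSet T) (hx : (lastPair n x).1 ∈ T) :
    Kernel.traj (X := fun _ => S × A) κ n x (visits A T n m) = 1 := by
  refine le_antisymm prob_le_one ?_
  have h := traj_preimage_fst_apply κ n x hT
  rw [Set.indicator_of_mem hx, Pi.one_apply] at h
  rw [← h, ← visits_zero]
  exact measure_mono (visits_mono T n (Nat.zero_le m))

lemma traj_visits_zero_of_notMem (n : ℕ) (x : Finset.Iic n → S × A) {T : Set S}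
    (hT : MeasurableSet T) (hx : (lastPair n x).1 ∉ T) :
    Kernel.traj (X := fun _ => S × A) κ n x (visits A T n 0) = 0 := by
  rw [visits_zero, traj_preimage_fst_apply κ n x hT, Set.indicator_of_notMem hx]

lemma traj_visits_succ_of_notMem (n m : ℕ) (x : Finset.Iic n → S × A) {T : Set S}
    (hT : MeasurableSet T) (hx : (lastPair n x).1 ∉ T) :
    Kernel.traj (X := fun _ => S × A) κ n x (visits A T n (m + 1)) =
      ∫⁻ y, Kernel.traj (X := fun _ => S × A) κ (n + 1) (extendHist n x y) (visits A T (n + 1) m)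
        ∂(κ n x) := by
  rw [← traj_apply_eq_lintegral_succ κ n x (measurableSet_visits hT (n + 1) m), visits_succ]
  refine le_antisymm ((measure_union_le _ _).trans ?_) (measure_mono Set.subset_union_right)
  rw [traj_preimage_fst_apply κ n x hT, Set.indicator_of_notMem hx, zero_add]

end Trajectories

/-! ### Upper bound on the reachability probability of a strategy -/

section PathMeasure

open scoped ENNReal

variable {S A : Type*} [TopologicalSpace S] [MeasurableSpace S]
  [TopologicalSpace A] [MeasurableSpace A] {M : MDP S A}

lemma lintegral_stepKernel (π : Strategy M) (n : ℕ) (x : Finset.Iic n → S × A)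
    {g : S × A → ℝ≥0∞} (hg : Measurable g) :
    ∫⁻ y, g y ∂(π.stepKernel n x) =
      ∫⁻ s, ∫⁻ a, g (s, a) ∂(π.act (n + 1) (toHist n (x, s))) ∂(M.trans (lastPair n x)) :=
  Kernel.lintegral_compProd _ _ _ hg

lemma pathMeasure_apply (π : Strategy M) (s : S) {E : Set (ℕ → S × A)} (hE : MeasurableSet E) :
    π.pathMeasure s E = ∫⁻ a, Kernel.traj (X := fun _ => S × A) π.stepKernel 0
      (fun _ => (s, a)) E ∂(π.act 0 (Fin.elim0, s)) := by
  have hm : Measurable fun a : A => (s, a) := measurable_prodMk_left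
  have hm' := (MeasurableEquiv.piUnique (fun _ : Finset.Iic 0 => S × A)).symm.measurable
  have hm2 : Measurable fun y : S × A => Kernel.traj (X := fun _ => S × A) π.stepKernel 0
      ((MeasurableEquiv.piUnique (fun _ : Finset.Iic 0 => S × A)).symm y) E :=
    (Kernel.measurable_coe _ hE).comp hm'
  rw [Strategy.pathMeasure, Kernel.trajMeasure, Measure.bind_apply hE (Kernel.aemeasurable _),
    lintegral_map (Kernel.measurable_coe _ hE) hm', Strategy.initLaw,
    lintegral_map hm2 hm]
  rfl

/-- The histories of pairs in which all actions are available and all successor states lie in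
the supports of the transitions. -/
def MDP.IsHistory (M : MDP S A) (n : ℕ) (x : Finset.Iic n → S × A) : Prop :=
  ∀ i (hi : i ≤ n), (x ⟨i, Finset.mem_Iic.2 hi⟩).2 ∈ M.av (x ⟨i, Finset.mem_Iic.2 hi⟩).1 ∧
    ∀ hi' : i + 1 ≤ n, (x ⟨i + 1, Finset.mem_Iic.2 hi'⟩).1 ∈
      (M.trans (x ⟨i, Finset.mem_Iic.2 hi⟩)).support

/-- A strategy is constrained only after finite paths; this makes the constraint applicable to the
histories on which the trajectory kernels operate. -/
lemma MDP.IsHistory.isFinPath {n : ℕ} {x : Finset.Iic n → S × A} (hx : M.IsHistory n x) {s : S}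
    (hs : s ∈ (M.trans (lastPair n x)).support) : M.IsFinPath (toHist n (x, s)) := by
  intro i
  have hin : i.1 ≤ n := Nat.lt_succ_iff.1 i.2
  refine ⟨(hx i.1 hin).1, ?_⟩
  rcases hin.eq_or_lt with h | h
  · have : i = Fin.last n := Fin.ext h
    subst this
    rw [Fin.succ_last, Fin.snoc_last]
    exact hs
  · have : i.succ = Fin.castSucc ⟨i.1 + 1, by omega⟩ := rfl
    rw [this, Fin.snoc_castSucc]
    exact (hx i.1 hin).2 h

lemma MDP.IsHistory.extendHist {n : ℕ} {x : Finset.Iic n → S × A} (hx : M.IsHistory n x)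
    {s : S} {a : A} (hs : s ∈ (M.trans (lastPair n x)).support) (ha : a ∈ M.av s) :
    M.IsHistory (n + 1) (extendHist n x (s, a)) := by
  intro i hi
  rcases Nat.le_succ_iff.1 hi with h | rfl
  · rw [extendHist_of_le x _ h]
    refine ⟨(hx i h).1, fun hi' => ?_⟩
    rcases h.eq_or_lt with rfl | h'
    · have := lastPair_extendHist i x (s, a)
      rw [lastPair] at this
      rw [this]
      exact hs
    · rw [extendHist_of_le x _ h']
      exact (hx i h).2 h'
  · have := lastPair_extendHist n x (s, a)
    rw [lastPair] at this
    rw [this]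
    exact ⟨ha, fun hi' => absurd hi' (by omega)⟩

variable {T : Set S}

instance (π : Strategy M) (s : S) : IsProbabilityMeasure (π.pathMeasure s) := by
  have : IsProbabilityMeasure (π.initLaw s) :=
    Measure.isProbabilityMeasure_map measurable_prodMk_left.aemeasurable
  unfold Strategy.pathMeasure
  infer_instance

lemma bddAbove_pathMeasure_eventually (s : S) :
    BddAbove (Set.range fun π : Strategy M => (π.pathMeasure s).real (eventually A T)) :=
  ⟨1, by rintro _ ⟨π, rfl⟩; exact measureReal_le_one⟩

lemma value_nonneg (s : S) : 0 ≤ M.value T s := Real.iSup_nonneg fun _ => measureReal_nonneg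

lemma iSup_horizonValue_le_one (s : S) : ⨆ k, M.horizonValue T k s ≤ 1 :=
  iSup_le fun k => horizonValue_le_one k s

lemma pairValue_nonneg (p : M.Pair) : 0 ≤ M.pairValue T p := by
  unfold MDP.pairValue
  split_ifs
  · exact zero_le_one
  · exact integral_nonneg value_nonneg

variable [HereditarilyLindelofSpace S] [HereditarilyLindelofSpace A]

/-- No strategy beats the optimal finite-horizon probability. -/
lemma traj_visits_le_horizonPairValue (hT : MeasurableSet T) (π : Strategy M) (m n : ℕ)
    (x : Finset.Iic n → S × A) (hx : M.IsHistory n x) :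
    Kernel.traj (X := fun _ => S × A) π.stepKernel n x (visits A T n m) ≤
      M.horizonPairValue T m (lastPair n x) := by
  induction m generalizing n with
  | zero =>
    by_cases h : (lastPair n x).1 ∈ T
    · rw [horizonPairValue_of_mem h]; exact prob_le_one
    · rw [traj_visits_zero_of_notMem _ _ _ hT h]; exact zero_le
  | succ m ih =>
    by_cases h : (lastPair n x).1 ∈ T
    · rw [horizonPairValue_of_mem h]; exact prob_le_one
    have hmeas : Measurable fun y => Kernel.traj (X := fun _ => S × A)
        π.stepKernel (n + 1) (extendHist n x y) (visits A T (n + 1) m) :=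
      (Kernel.measurable_coe _ (measurableSet_visits hT _ _)).comp (measurable_extendHist n x)
    rw [traj_visits_succ_of_notMem _ _ _ _ hT h, horizonPairValue_succ_of_notMem h,
      lintegral_stepKernel π n x hmeas]
    refine lintegral_mono_ae ?_
    -- Almost every successor lies in the support, so the extended history is a path; almost every
    -- action is then available by `support_subset`.
    filter_upwards [Measure.support_mem_ae (μ := M.trans (lastPair n x))] with s hs
    have hle : ∀ᵐ a ∂(π.act (n + 1) (toHist n (x, s))),
        Kernel.traj (X := fun _ => S × A) π.stepKernel (n + 1) (extendHist n x (s, a))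
          (visits A T (n + 1) m) ≤ M.horizonValue T m s := by
      filter_upwards [Measure.support_mem_ae (μ := π.act (n + 1) (toHist n (x, s)))] with a ha
      have hav : a ∈ M.av s := π.support_subset _ _ (hx.isFinPath hs) ha
      refine (ih (n + 1) _ (hx.extendHist hs hav)).trans ?_
      rw [lastPair_extendHist]
      exact horizonPairValue_le_horizonValue hav
    refine (lintegral_mono_ae hle).trans ?_
    simp

lemma pathMeasure_visits_le_horizonValue (hT : MeasurableSet T) (π : Strategy M) (m : ℕ) (s : S) :
    π.pathMeasure s (visits A T 0 m) ≤ M.horizonValue T m s := by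
  rw [pathMeasure_apply π s (measurableSet_visits hT 0 m)]
  have hle : ∀ᵐ a ∂(π.act 0 (Fin.elim0, s)),
      Kernel.traj (X := fun _ => S × A) π.stepKernel 0 (fun _ => (s, a)) (visits A T 0 m) ≤
        M.horizonValue T m s := by
    filter_upwards [Measure.support_mem_ae (μ := π.act 0 (Fin.elim0, s))] with a ha
    have hav : a ∈ M.av s := π.support_subset 0 (Fin.elim0, s) (fun i => i.elim0) ha
    refine (traj_visits_le_horizonPairValue hT π m 0 _ fun i _ => ⟨hav, ?_⟩).trans
      (horizonPairValue_le_horizonValue hav)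
    exact fun hi => absurd hi (by omega)
  refine (lintegral_mono_ae hle).trans ?_
  have : IsProbabilityMeasure (π.act 0 (Fin.elim0, s)) := inferInstance
  simp

lemma pathMeasure_eventually_le (hT : MeasurableSet T) (π : Strategy M) (s : S) :
    π.pathMeasure s (eventually A T) ≤ ⨆ m, M.horizonValue T m s := by
  rw [eventually_eq_iUnion_visits, (visits_mono T 0).measure_iUnion]
  exact iSup_mono fun m => pathMeasure_visits_le_horizonValue hT π m s

end PathMeasure

/-! ### Policies as strategies -/

section Policies

open scoped ENNReal

variable {S A : Type*} [MetricSpace S] [MeasurableSpace S]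
  [MetricSpace A] [MeasurableSpace A] [BorelSpace A] {M : MDP S A} {T : Set S}

/-- The strategy given by a time-dependent measurable choice of actions. -/
def policyStrategy (f : ℕ → S → A) (hfm : ∀ i, Measurable (f i)) (hf : ∀ i s, f i s ∈ M.av s) :
    Strategy M where
  act n := Kernel.deterministic (fun h => f n h.2) ((hfm n).comp measurable_snd)
  markov _ := inferInstance
  support_subset n h _ := by
    refine (Measure.support_subset_of_isClosed isClosed_singleton (t := {f n h.2}) ?_).trans
      (Set.singleton_subset_iff.2 (hf n h.2))
    rw [Kernel.deterministic_apply, mem_ae_dirac_iff (measurableSet_singleton _)]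
    rfl

variable (f : ℕ → S → A) (hfm : ∀ i, Measurable (f i)) (hf : ∀ i s, f i s ∈ M.av s)

/-- The recursion of `traj_visits_le_horizonPairValue` becomes an equality because the action laws
are Dirac measures. By `hx`, the action already recorded at time `n` is the policy's own; earlier
entries are irrelevant. -/
lemma traj_visits_policyStrategy (hT : MeasurableSet T) (m n : ℕ) (x : Finset.Iic n → S × A)
    (hx : (lastPair n x).2 = f n (lastPair n x).1) :
    Kernel.traj (X := fun _ => S × A) (policyStrategy f hfm hf).stepKernel n x (visits A T n m) =
      M.policyValue T m (fun i => f (n + i)) (lastPair n x).1 := by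
  induction m generalizing n with
  | zero =>
    by_cases h : (lastPair n x).1 ∈ T
    · rw [policyValue_of_mem h, traj_visits_of_mem _ _ _ _ hT h]
    · rw [traj_visits_zero_of_notMem _ _ _ hT h, policyValue_zero_of_notMem h]
  | succ m ih =>
    by_cases h : (lastPair n x).1 ∈ T
    · rw [policyValue_of_mem h, traj_visits_of_mem _ _ _ _ hT h]
    have hmeas : Measurable fun y => Kernel.traj (X := fun _ => S × A)
        (policyStrategy f hfm hf).stepKernel (n + 1) (extendHist n x y) (visits A T (n + 1) m) :=
      (Kernel.measurable_coe _ (measurableSet_visits hT _ _)).comp (measurable_extendHist n x)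
    rw [traj_visits_succ_of_notMem _ _ _ _ hT h, policyValue_succ_of_notMem h,
      lintegral_stepKernel _ n x hmeas]
    have hlast : ((lastPair n x).1, f (n + 0) (lastPair n x).1) = lastPair n x :=
      Prod.ext rfl hx.symm
    rw [hlast]
    refine lintegral_congr fun s => ?_
    have hact : (policyStrategy f hfm hf).act (n + 1) (toHist n (x, s)) =
        Measure.dirac (f (n + 1) s) := rfl
    have hmeas' : Measurable fun a : A => Kernel.traj (X := fun _ => S × A)
        (policyStrategy f hfm hf).stepKernel (n + 1) (extendHist n x (s, a))
        (visits A T (n + 1) m) := hmeas.comp measurable_prodMk_left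
    rw [hact, lintegral_dirac' _ hmeas', ih (n + 1) _ (by simp),
      lastPair_extendHist]
    congr 1
    funext i
    rw [add_assoc, add_comm 1 i]

lemma pathMeasure_visits_policyStrategy (hT : MeasurableSet T) (m : ℕ) (s : S) :
    (policyStrategy f hfm hf).pathMeasure s (visits A T 0 m) = M.policyValue T m f s := by
  have hact : (policyStrategy f hfm hf).act 0 (Fin.elim0, s) = Measure.dirac (f 0 s) := rfl
  have hm : Measurable fun a : A => (fun _ : Finset.Iic 0 => (s, a)) :=
    measurable_pi_lambda _ fun _ => measurable_prodMk_left
  have hm2 : Measurable fun a : A => Kernel.traj (X := fun _ => S × A)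
      (policyStrategy f hfm hf).stepKernel 0 (fun _ => (s, a)) (visits A T 0 m) :=
    (Kernel.measurable_coe _ (measurableSet_visits hT _ _)).comp hm
  rw [pathMeasure_apply _ s (measurableSet_visits hT 0 m), hact, lintegral_dirac' _ hm2,
    traj_visits_policyStrategy f hfm hf hT m 0 _ rfl]
  simp [lastPair]

variable [CompactSpace A]

lemma nonempty_strategy (M : MDP S A) : Nonempty (Strategy M) := by
  obtain ⟨f, hfm, hf⟩ := exists_measurable_selector M
  exact ⟨policyStrategy (fun _ => f) (fun _ => hfm) fun _ => hf⟩

lemma value_le_one (s : S) : M.value T s ≤ 1 := by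
  have := nonempty_strategy M
  exact ciSup_le fun _ => measureReal_le_one

end Policies

/-! ### The value as limit of finite horizons, and the Bellman inequality -/

section Value

open scoped ENNReal

variable {S A : Type*} [MetricSpace S] [CompactSpace S] [MeasurableSpace S] [BorelSpace S]
  [MetricSpace A] [CompactSpace A] [MeasurableSpace A] [BorelSpace A] {M : MDP S A} {T : Set S}

/-- The value is the limit of the optimal finite-horizon probabilities. -/
theorem ofReal_value (hT : MeasurableSet T) (s : S) :
    ENNReal.ofReal (M.value T s) = ⨆ k, M.horizonValue T k s := by
  have := nonempty_strategy M
  have hfin : ⨆ k, M.horizonValue T k s ≠ ∞ :=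
    ne_top_of_le_ne_top ENNReal.one_ne_top (iSup_horizonValue_le_one s)
  refine le_antisymm (ENNReal.ofReal_le_of_le_toReal (ciSup_le fun π =>
    ENNReal.toReal_mono hfin (pathMeasure_eventually_le hT π s))) (iSup_le fun k => ?_)
  refine ENNReal.le_of_forall_pos_le_add fun ε hε _ => ?_
  -- Near-optimality on average becomes near-optimality at `s` when the initial law is the Dirac
  -- measure.
  obtain ⟨f, hfm, hf, hle⟩ := exists_nearly_optimal_policy (M := M) hT k (Measure.dirac s)
    (ε := ε) (by simpa using hε.ne')
  rw [lintegral_dirac, lintegral_dirac] at hle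
  refine hle.trans (add_le_add_left ?_ _)
  rw [← pathMeasure_visits_policyStrategy f hfm hf hT k s]
  calc (policyStrategy f hfm hf).pathMeasure s (visits A T 0 k)
      ≤ (policyStrategy f hfm hf).pathMeasure s (eventually A T) := by
        rw [eventually_eq_iUnion_visits]
        exact measure_mono (Set.subset_iUnion _ k)
    _ = ENNReal.ofReal (((policyStrategy f hfm hf).pathMeasure s).real (eventually A T)) :=
        (ENNReal.ofReal_toReal (measure_ne_top _ _)).symm
    _ ≤ ENNReal.ofReal (M.value T s) :=
        ENNReal.ofReal_le_ofReal (le_ciSup (bddAbove_pathMeasure_eventually s) _)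

lemma aemeasurable_value (hT : MeasurableSet T) (μ : Measure S) [IsFiniteMeasure μ] :
    AEMeasurable (M.value T) μ := by
  have h : M.value T = fun s => (⨆ k, M.horizonValue T k s).toReal := by
    funext s
    rw [← ofReal_value hT, ENNReal.toReal_ofReal (value_nonneg s)]
  rw [h]
  exact (AEMeasurable.iSup fun k => (upperSemianalytic_horizonValue hT k).aemeasurable μ).ennreal_toReal

lemma integrable_value (hT : MeasurableSet T) (μ : Measure S) [IsFiniteMeasure μ] :
    Integrable (M.value T) μ :=
  Integrable.of_bound (aemeasurable_value hT μ).aestronglyMeasurable 1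
    (Eventually.of_forall fun s => by
      rw [Real.norm_of_nonneg (value_nonneg s)]; exact value_le_one s)

lemma ofReal_integral_value (hT : MeasurableSet T) (μ : Measure S) [IsFiniteMeasure μ] :
    ENNReal.ofReal (∫ s, M.value T s ∂μ) = ⨆ k, ∫⁻ s, M.horizonValue T k s ∂μ := by
  rw [ofReal_integral_eq_lintegral_ofReal (integrable_value hT μ)
    (Eventually.of_forall value_nonneg), lintegral_congr (ofReal_value hT),
    lintegral_iSup' (fun k => (upperSemianalytic_horizonValue hT k).aemeasurable μ)
      (Eventually.of_forall horizonValue_mono)]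

lemma value_of_mem (hT : MeasurableSet T) {s : S} (hs : s ∈ T) : M.value T s = 1 := by
  refine le_antisymm (value_le_one s) ?_
  rw [← ENNReal.ofReal_le_ofReal_iff (value_nonneg s), ofReal_value hT, ENNReal.ofReal_one]
  obtain ⟨a, ha⟩ := M.av_nonempty s
  refine le_trans ?_ (le_iSup (fun k => M.horizonValue T k s) 0)
  rw [← horizonPairValue_of_mem (M := M) (k := 0) (p := (s, a)) hs]
  exact horizonPairValue_le_horizonValue ha

/-- One inequality of the Bellman equation. -/
theorem pairValue_le_value (hT : MeasurableSet T) (p : M.Pair) :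
    M.pairValue T p ≤ M.value T p.state := by
  unfold MDP.pairValue
  split_ifs with h
  · exact (value_of_mem hT h).ge
  -- Both sides are suprema over horizons, and the integral of the `k`-step value is the pair value
  -- for `k + 1` steps.
  rw [← ENNReal.ofReal_le_ofReal_iff (value_nonneg _), ofReal_integral_value hT, ofReal_value hT]
  refine iSup_le fun k => le_trans ?_ (le_iSup (fun k => M.horizonValue T k p.state) (k + 1))
  rw [← horizonPairValue_succ_of_notMem h]
  exact horizonPairValue_le_horizonValue p.2

end Value

/-! ### Total variation: countable tests and integrals -/

section TotalVariation

variable {X : Type*} [MeasurableSpace X]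

lemma abs_measureReal_sub_le_tvDist (μ ν : Measure X) [IsProbabilityMeasure μ]
    [IsProbabilityMeasure ν] {Y : Set X} (hY : MeasurableSet Y) :
    2 * |μ.real Y - ν.real Y| ≤ tvDist μ ν := by
  refine mul_le_mul_of_nonneg_left ?_ zero_le_two
  refine le_ciSup (f := fun Y : {Y : Set X // MeasurableSet Y} => |μ.real Y.1 - ν.real Y.1|)
    ⟨1, ?_⟩ ⟨Y, hY⟩
  rintro _ ⟨Z, rfl⟩
  have h1 := measureReal_le_one (μ := μ) (s := Z.1)
  have h2 := measureReal_le_one (μ := ν) (s := Z.1)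
  have h3 := measureReal_nonneg (μ := μ) (s := Z.1)
  have h4 := measureReal_nonneg (μ := ν) (s := Z.1)
  exact abs_sub_le_iff.2 ⟨by linarith, by linarith⟩

/-- On a countably generated space, countably many measurable sets suffice to compare
finite measures. -/
lemma exists_countable_comparing_sets (X : Type*) [MeasurableSpace X]
    [MeasurableSpace.CountablyGenerated X] :
    ∃ 𝒜 : Set (Set X), 𝒜.Countable ∧ (∀ Y ∈ 𝒜, MeasurableSet Y) ∧
      ∀ (μ ν : Measure X) [IsFiniteMeasure μ] [IsFiniteMeasure ν] (c : ℝ),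
        (∀ Y ∈ 𝒜, |μ.real Y - ν.real Y| ≤ c) →
          ∀ Y, MeasurableSet Y → |μ.real Y - ν.real Y| ≤ c := by
  obtain ⟨b, hb, hgen⟩ := MeasurableSpace.CountablyGenerated.isCountablyGenerated (α := X)
  have hgen' : MeasurableSpace.generateFrom (generateSetAlgebra b) = ‹MeasurableSpace X› := by
    rw [generateFrom_generateSetAlgebra_eq, hgen]
  have hmeas : ∀ Y ∈ generateSetAlgebra b, MeasurableSet Y := fun Y hY => by
    rw [← hgen']
    exact MeasurableSpace.measurableSet_generateFrom hY
  refine ⟨generateSetAlgebra b, countable_generateSetAlgebra hb, hmeas, ?_⟩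
  intro μ ν _ _ c h Y hY
  -- Approximating with respect to `μ + ν` gives one set of the algebra that serves both measures.
  have hdense := Measure.MeasureDense.of_generateFrom_isSetAlgebra_finite (μ := μ + ν)
    isSetAlgebra_generateSetAlgebra hgen'.symm
  refine le_of_forall_pos_le_add fun η hη => ?_
  obtain ⟨Z, hZ, hlt⟩ := hdense.approx Y hY (measure_ne_top _ _) (η / 2) (by positivity)
  have key : ∀ ρ : Measure X, IsFiniteMeasure ρ → ρ ≤ μ + ν →
      |ρ.real Y - ρ.real Z| ≤ η / 2 := fun ρ _ hρ => by
    refine (abs_measureReal_sub_le_measureReal_symmDiff hY.nullMeasurableSet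
      (hmeas Z hZ).nullMeasurableSet).trans ?_
    exact ENNReal.toReal_le_of_le_ofReal (by positivity) ((hρ _).trans hlt.le)
  have h1 := abs_le.1 (key μ inferInstance (Measure.le_add_right le_rfl))
  have h2 := abs_le.1 (key ν inferInstance (Measure.le_add_left le_rfl))
  have h3 := abs_le.1 (h Z hZ)
  exact abs_le.2 ⟨by linarith, by linarith⟩

/-- Integrals of functions with values in the unit interval against measures that are close on
all measurable sets. -/
lemma integral_le_integral_add_of_abs_measureReal_sub_le (μ ν : Measure X)
    [IsProbabilityMeasure μ] [IsProbabilityMeasure ν] {c : ℝ}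
    (h : ∀ Y, MeasurableSet Y → |μ.real Y - ν.real Y| ≤ c) {f : X → ℝ} (hf : Measurable f)
    (hf01 : ∀ x, f x ∈ Set.Icc (0 : ℝ) 1) : ∫ x, f x ∂μ ≤ ∫ x, f x ∂ν + c := by
  -- Layer-cake formula: the levels fill an interval of length `1`, so the error `c` on sets enters
  -- the integral with factor `1`.
  have hlayer : ∀ ρ : Measure X, IsProbabilityMeasure ρ →
      ∫ x, f x ∂ρ = ∫ t in Set.Ioc 0 1, ρ.real {x | t ≤ f x} := fun ρ _ =>
    Integrable.integral_eq_integral_Ioc_meas_le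
      (Integrable.of_bound hf.aestronglyMeasurable 1 (Eventually.of_forall fun x => by
        rw [Real.norm_of_nonneg (hf01 x).1]; exact (hf01 x).2))
      (Eventually.of_forall fun x => (hf01 x).1) (Eventually.of_forall fun x => (hf01 x).2)
  have hint : ∀ ρ : Measure X, IsProbabilityMeasure ρ →
      IntegrableOn (fun t : ℝ => ρ.real {x | t ≤ f x}) (Set.Ioc 0 1) := fun ρ _ => by
    have hanti : Antitone fun t : ℝ => ρ.real {x | t ≤ f x} := fun a b hab =>
      measureReal_mono fun x (hx : b ≤ f x) => hab.trans hx
    exact (hanti.intervalIntegrable (a := 0) (b := 1)).1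
  rw [hlayer μ inferInstance, hlayer ν inferInstance]
  have hc : ∫ _t in Set.Ioc (0 : ℝ) 1, c = c := by simp
  rw [← hc, ← integral_add (hint ν inferInstance) (by simp)]
  refine integral_mono (hint μ inferInstance) ((hint ν inferInstance).add (by simp)) fun t => ?_
  have := (abs_le.1 (h {x | t ≤ f x} (measurableSet_le measurable_const hf))).2
  simp only
  linarith

end TotalVariation

/-! ### One null set for all reachable pairs -/

section Sampling

/-- If every set of a family of measurable sets is hit almost surely by a sequence of random
points, then countably many of these sets meet all of them. -/
lemma exists_countable_of_ae_hit {Q Ω : Type*} [MeasurableSpace Q] [MeasurableSpace Ω]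
    (P : Measure Ω) [IsProbabilityMeasure P] (q : ℕ → Ω → Q) (hq : ∀ t, Measurable (q t))
    (R : Set Q) (N : Q → Set Q) (hN : ∀ p, MeasurableSet (N p))
    (hhit : ∀ p ∈ R, ∀ᵐ ω ∂P, ∃ t, q t ω ∈ N p) :
    ∃ E ⊆ R, E.Countable ∧ ∀ p ∈ R, ∃ p' ∈ E, (N p ∩ N p').Nonempty := by
  obtain ⟨E, hE⟩ := zorn_subset {E : Set Q | E ⊆ R ∧ E.PairwiseDisjoint N} fun c hc hchain =>
    ⟨⋃₀ c, ⟨Set.sUnion_subset fun E hE => (hc hE).1,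
      (Set.pairwiseDisjoint_sUnion hchain.directedOn).2 fun E hE => (hc hE).2⟩,
      fun E hE => Set.subset_sUnion_of_mem hE⟩
  obtain ⟨hER, hdisj⟩ := hE.prop
  refine ⟨E, hER, ?_, fun p hp => ?_⟩
  -- At a fixed time only countably many disjoint neighbourhoods are hit with positive probability,
  -- and each member of `E` is among them at some time.
  · have hcount : ∀ t, {p : E | 0 < P (q t ⁻¹' N p)}.Countable := fun t =>
      Measure.countable_meas_pos_of_disjoint_iUnion (fun p => hq t (hN p)) fun p p' hpp' =>
        (hdisj p.2 p'.2 fun h => hpp' (Subtype.ext h)).preimage (q t)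
    have hcover : (Set.univ : Set E) ⊆ ⋃ t, {p : E | 0 < P (q t ⁻¹' N p)} := by
      intro p _
      by_contra hnot
      simp only [Set.mem_iUnion, Set.mem_ofPred_eq, not_exists, not_lt, nonpos_iff_eq_zero] at hnot
      have h0 : P (⋃ t, q t ⁻¹' N p) = 0 := measure_iUnion_null hnot
      have h1 : P (⋃ t, q t ⁻¹' N p) = 1 := by
        rw [← prob_compl_eq_zero_iff (MeasurableSet.iUnion fun t => hq t (hN p))]
        have := hhit p (hER p.2)
        rw [ae_iff] at this
        convert this using 2
        ext ω
        simp
      exact one_ne_zero (h1.symm.trans h0)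
    have := (Set.countable_iUnion hcount).mono hcover
    exact Set.countable_coe_iff.1 (Set.countable_univ_iff.1 this)
  · by_cases hpE : p ∈ E
    · obtain ⟨ω, t, ht⟩ := (hhit p hp).exists
      exact ⟨p, hpE, _, ht, ht⟩
    by_contra hnone
    refine hpE (hE.le_of_ge (y := insert p E) ⟨Set.insert_subset hp hER, ?_⟩
      (Set.subset_insert p E) (Set.mem_insert p E))
    refine hdisj.insert fun p' hp' _ => ?_
    rw [Set.disjoint_iff_inter_eq_empty, ← Set.not_nonempty_iff_eq_empty]
    exact fun hne => hnone ⟨p', hp', hne⟩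

variable {S A : Type*} [MetricSpace S] [MeasurableSpace S] [MetricSpace A] [MeasurableSpace A]
  {M : MDP S A}

lemma PairMetric.d_self (D : PairMetric M) (p : M.Pair) : D.d p p = 0 := (D.eq_zero_iff p p).2 rfl

lemma PairMetric.d_nonneg (D : PairMetric M) (p q : M.Pair) : 0 ≤ D.d p q := by
  have h := D.triangle p q p
  rw [D.d_self, D.symm q p] at h
  linarith

variable [SecondCountableTopology S] [BorelSpace S]

/-- Almost surely, all reachable pairs are simultaneously approximated infinitely often. -/
theorem Sampling.ae_forall_frequently {D : PairMetric M} {T : Set S} (hT : MeasurableSet T)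
    {s₀ : S} {Ω : Type*} [MeasurableSpace Ω] {P : Measure Ω} [IsProbabilityMeasure P]
    {getPair : ℕ → Ω → M.Pair} (hmeas : ∀ t, Measurable (getPair t))
    (hs : Sampling D T s₀ P getPair) :
    ∀ᵐ ω ∂P, ∀ p : M.Pair, p.state ∈ M.reachable s₀ → ∀ ε > 0, ∃ᶠ t in atTop,
      D.d p (getPair t ω) < ε ∧
      (∀ Y, MeasurableSet Y →
        |(M.trans p.1).real Y - (M.trans (getPair t ω).1).real Y| ≤ ε) ∧
      (p.state ∈ T → (getPair t ω).state ∈ T) := by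
  -- Testing on the countable family `𝒜` makes the total variation neighbourhoods measurable.
  obtain ⟨𝒜, h𝒜c, h𝒜m, h𝒜⟩ := exists_countable_comparing_sets S
  let N (ε : ℝ) (p : M.Pair) : Set M.Pair := {q | D.d p q < ε ∧
    (∀ Y ∈ 𝒜, |(M.trans p.1).real Y - (M.trans q.1).real Y| ≤ ε) ∧
    (p.state ∈ T → q.state ∈ T)}
  have hN : ∀ ε p, MeasurableSet (N ε p) := fun ε p => by
    have h1 : MeasurableSet {q | D.d p q < ε} := measurableSet_lt (D.measurable p) measurable_const
    have h2 : MeasurableSet {q : M.Pair | ∀ Y ∈ 𝒜,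
        |(M.trans p.1).real Y - (M.trans q.1).real Y| ≤ ε} := by
      have : {q : M.Pair | ∀ Y ∈ 𝒜, |(M.trans p.1).real Y - (M.trans q.1).real Y| ≤ ε} =
          ⋂ Y ∈ 𝒜, {q : M.Pair | |(M.trans p.1).real Y - (M.trans q.1).real Y| ≤ ε} := by
        ext q; simp
      rw [this]
      refine MeasurableSet.biInter h𝒜c fun Y hY => measurableSet_le ?_ measurable_const
      have hm : Measurable fun q : M.Pair => (M.trans q.1).real Y :=
        ((Kernel.measurable_coe M.trans (h𝒜m Y hY)).comp measurable_subtype_coe).ennreal_toReal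
      exact (measurable_const.sub hm).abs
    have h3 : MeasurableSet {q : M.Pair | p.state ∈ T → q.state ∈ T} := by
      by_cases hp : p.state ∈ T
      · simp only [hp, true_imp_iff]
        exact (measurable_fst.comp measurable_subtype_coe) hT
      · simp [hp]
    exact h1.inter (h2.inter h3)
  have hfreq : ∀ ε > 0, ∀ p : M.Pair, p.state ∈ M.reachable s₀ →
      ∀ᵐ ω ∂P, ∃ᶠ t in atTop, getPair t ω ∈ N ε p := fun ε hε p hp => by
    filter_upwards [hs ε hε p hp] with ω hω
    refine hω.mono fun t ht => ⟨ht.1, fun Y hY => ?_, ht.2.2⟩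
    have := abs_measureReal_sub_le_tvDist (M.trans p.1) (M.trans (getPair t ω).1) (h𝒜m Y hY)
    have := abs_nonneg ((M.trans p.1).real Y - (M.trans (getPair t ω).1).real Y)
    linarith [ht.2.1]
  have hcover : ∀ (n : ℕ) (B : Set M.Pair), (∀ p ∈ B, p.state ∈ M.reachable s₀) →
      ∃ E ⊆ B, E.Countable ∧ ∀ p ∈ B, ∃ p' ∈ E,
        (N (1 / ((n : ℝ) + 1)) p ∩ N (1 / ((n : ℝ) + 1)) p').Nonempty := fun n B hB =>
    exists_countable_of_ae_hit P getPair hmeas B _ (hN _) fun p hp => by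
      filter_upwards [hfreq _ (show (0 : ℝ) < 1 / ((n : ℝ) + 1) by positivity) p (hB p hp)]
        with ω hω
      exact hω.exists
  -- Target and non-target pairs are covered separately, so that a target pair is represented by a
  -- target pair and the target clause transfers.
  choose E₁ hE₁ hE₁c hE₁n using fun n => hcover n
    {p | p.state ∈ M.reachable s₀ ∧ p.state ∈ T} fun p hp => hp.1
  choose E₂ hE₂ hE₂c hE₂n using fun n => hcover n
    {p | p.state ∈ M.reachable s₀ ∧ p.state ∉ T} fun p hp => hp.1
  have hall : ∀ᵐ ω ∂P, ∀ n, ∀ p ∈ E₁ n ∪ E₂ n,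
      ∃ᶠ t in atTop, getPair t ω ∈ N (1 / ((n : ℝ) + 1)) p := by
    refine ae_all_iff.2 fun n => (ae_ball_iff ((hE₁c n).union (hE₂c n))).2 fun p hp => ?_
    refine hfreq _ (by positivity) p ?_
    rcases hp with hp | hp
    exacts [(hE₁ n hp).1, (hE₂ n hp).1]
  filter_upwards [hall] with ω hω p hp ε hε
  -- The route from `p` to the sample has three legs: to a common neighbour `q`, on to the
  -- representative `p'`, then to the sample.
  obtain ⟨n, hn⟩ := exists_nat_one_div_lt (show 0 < ε / 3 by positivity)
  obtain ⟨p', hp', hTT, q, hq, hq'⟩ : ∃ p' ∈ E₁ n ∪ E₂ n, (p.state ∈ T → p'.state ∈ T) ∧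
      (N (1 / ((n : ℝ) + 1)) p ∩ N (1 / ((n : ℝ) + 1)) p').Nonempty := by
    by_cases hpT : p.state ∈ T
    · obtain ⟨p', h1, h2⟩ := hE₁n n p ⟨hp, hpT⟩
      exact ⟨p', Or.inl h1, fun _ => (hE₁ n h1).2, h2⟩
    · obtain ⟨p', h1, h2⟩ := hE₂n n p ⟨hp, hpT⟩
      exact ⟨p', Or.inr h1, fun h => absurd h hpT, h2⟩
  refine (hω n p' hp').mono fun t ht => ⟨?_, h𝒜 _ _ _ fun Y hY => ?_, fun h => ht.2.2 (hTT h)⟩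
  · have h1 := D.triangle p q (getPair t ω)
    have h2 := D.triangle q p' (getPair t ω)
    rw [D.symm q p'] at h2
    linarith [hq.1, hq'.1, ht.1]
  · have h1 := abs_le.1 (hq.2.1 Y hY)
    have h2 := abs_le.1 (hq'.2.1 Y hY)
    have h3 := abs_le.1 (ht.2.1 Y hY)
    exact abs_le.2 ⟨by linarith, by linarith⟩

end Sampling

/-! ### Reachable states are closed under transitions -/

section Reachable

variable {S A : Type*} [TopologicalSpace S] [MeasurableSpace S]
  [TopologicalSpace A] [MeasurableSpace A] {M : MDP S A} {s₀ : S}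

lemma self_mem_reachable (M : MDP S A) (s₀ : S) : s₀ ∈ M.reachable s₀ :=
  ⟨0, (Fin.elim0, s₀), fun i => i.elim0, rfl, rfl⟩

lemma mem_reachable_of_mem_support {s s' : S} {a : A} (hs : s ∈ M.reachable s₀)
    (ha : a ∈ M.av s) (hs' : s' ∈ (M.trans (s, a)).support) : s' ∈ M.reachable s₀ := by
  obtain ⟨n, h, hpath, hfirst, rfl⟩ := hs
  let g : Fin (n + 1) → S × A := Fin.snoc (α := fun _ => S × A) h.1 (h.2, a)
  have hstates : (fun j => (g j).1) =
      (Fin.snoc (α := fun _ => S) (fun j => (h.1 j).1) h.2 : Fin (n + 1) → S) := by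
    funext j
    refine Fin.lastCases ?_ (fun j => ?_) j <;> simp [g]
  refine ⟨n + 1, (g, s'), fun i => ?_, ?_, rfl⟩
  · dsimp only
    rw [hstates]
    refine Fin.lastCases ?_ (fun j => ?_) i
    · rw [Fin.succ_last, Fin.snoc_last]
      simpa [g] using ⟨ha, hs'⟩
    · rw [Fin.succ_castSucc, Fin.snoc_castSucc]
      simpa [g] using hpath j
  · rw [← hfirst]
    unfold firstState
    dsimp only
    rw [hstates, ← Fin.castSucc_zero, Fin.snoc_castSucc]

end Reachable

/-! ### Extrapolated bounds -/

section Bounds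

variable {S A : Type*} [MetricSpace S] [MeasurableSpace S] [MetricSpace A] [MeasurableSpace A]
  {M : MDP S A} {D : PairMetric M} {CP : ℝ}

lemma pairBound_le_iff {σ : VIState M} {p : M.Pair} {c : ℝ} :
    σ.pairBound D CP p ≤ c ↔ 0 ≤ c ∧ ∀ q ∈ σ.sampled, σ.stored q - CP * D.d p q ≤ c := by
  simp only [VIState.pairBound, Finset.max'_le_iff, Finset.forall_mem_insert,
    Finset.forall_mem_image]

lemma pairBound_nonneg (σ : VIState M) (p : M.Pair) : 0 ≤ σ.pairBound D CP p :=
  (pairBound_le_iff.1 le_rfl).1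

lemma le_pairBound {σ : VIState M} {q : M.Pair} (hq : q ∈ σ.sampled) (p : M.Pair) :
    σ.stored q - CP * D.d p q ≤ σ.pairBound D CP p :=
  (pairBound_le_iff.1 le_rfl).2 q hq

lemma pairBound_le_add (hCP : 0 ≤ CP) (σ : VIState M) (p p' : M.Pair) :
    σ.pairBound D CP p ≤ σ.pairBound D CP p' + CP * D.d p p' := by
  refine pairBound_le_iff.2 ⟨add_nonneg (pairBound_nonneg σ p')
    (mul_nonneg hCP (D.d_nonneg p p')), fun q hq => ?_⟩
  have h1 := le_pairBound (D := D) (CP := CP) hq p'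
  have h2 := mul_le_mul_of_nonneg_left (D.triangle p' p q) hCP
  rw [D.symm p' p] at h2
  linarith

lemma abs_pairBound_sub_le (hCP : 0 ≤ CP) (σ : VIState M) (p p' : M.Pair) :
    |σ.pairBound D CP p - σ.pairBound D CP p'| ≤ CP * D.d p p' := by
  have h1 := pairBound_le_add (D := D) hCP σ p p'
  have h2 := pairBound_le_add (D := D) hCP σ p' p
  rw [D.symm p' p] at h2
  exact abs_sub_le_iff.2 ⟨by linarith, by linarith⟩

lemma measurable_pairBound (σ : VIState M) : Measurable (σ.pairBound D CP) := by
  refine measurable_of_Iic fun c => ?_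
  have : σ.pairBound D CP ⁻¹' Set.Iic c =
      {_p | 0 ≤ c} ∩ ⋂ q ∈ σ.sampled, {p | σ.stored q - CP * D.d p q ≤ c} := by
    ext p
    simp [pairBound_le_iff]
  rw [this]
  refine (MeasurableSet.const _).inter (Finset.measurableSet_biInter _ fun q _ => ?_)
  simp_rw [fun p => D.symm p q]
  exact measurableSet_le (measurable_const.sub ((D.measurable q).const_mul CP)) measurable_const

lemma exists_lipschitzWith_pairBound (hCP : 0 ≤ CP) (σ : VIState M) (s : S) :
    ∃ K, LipschitzWith K fun a : M.av s => σ.pairBound D CP (M.pair s a) := by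
  obtain ⟨k, K, -, hK, hact, -⟩ := D.compatible
  refine ⟨(CP * K).toNNReal, LipschitzWith.of_dist_le_mul fun a b => ?_⟩
  refine (abs_pairBound_sub_le hCP σ _ _).trans ?_
  rw [Real.coe_toNNReal _ (mul_nonneg hCP hK), mul_assoc]
  exact mul_le_mul_of_nonneg_left (hact (M.pair s a) (M.pair s b) rfl).2 hCP

/-- The stored bounds are correct. -/
def VIState.Sound (T : Set S) (σ : VIState M) : Prop := ∀ q, σ.stored q ≤ M.pairValue T q

/-- The later state has sampled more pairs and stores better bounds. -/
def VIState.Improves (σ σ' : VIState M) : Prop :=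
  σ.sampled ⊆ σ'.sampled ∧ ∀ q, σ.stored q ≤ σ'.stored q

lemma VIState.Improves.pairBound_le {σ σ' : VIState M} (h : σ.Improves σ') (p : M.Pair) :
    σ.pairBound D CP p ≤ σ'.pairBound D CP p :=
  pairBound_le_iff.2 ⟨pairBound_nonneg σ' p, fun q hq =>
    (sub_le_sub_right (h.2 q) _).trans (le_pairBound (h.1 hq) p)⟩

/-- Lowering a correct bound at `q` by `CP * D.d p q` makes it correct at `p`, since the pair value
varies by no more than that. -/
lemma VIState.Sound.pairBound_le_pairValue {T : Set S} {CS : ℝ} {σ : VIState M} (hσ : σ.Sound T)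
    (hC : ValueLipschitz D T CS CP) (p : M.Pair) : σ.pairBound D CP p ≤ M.pairValue T p := by
  refine pairBound_le_iff.2 ⟨pairValue_nonneg p, fun q _ => ?_⟩
  have h1 := (abs_le.1 (hC.2 p q)).1
  have h2 := hσ q
  linarith

variable {T : Set S}

lemma pairValue_of_mem {p : M.Pair} (h : p.state ∈ T) : M.pairValue T p = 1 := if_pos h

lemma pairValue_of_notMem {p : M.Pair} (h : p.state ∉ T) :
    M.pairValue T p = ∫ s, M.value T s ∂(M.trans p.1) := if_neg h

lemma mem_sampled_update (σ : VIState M) (O : Approx M) (prec : ℕ → ℝ) (t : ℕ) (p : M.Pair) :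
    p ∈ (σ.update D CP T O prec t p).sampled := by
  simp [VIState.update]

lemma stored_update_of_mem (σ : VIState M) (O : Approx M) (prec : ℕ → ℝ) (t : ℕ) {p : M.Pair}
    (hp : p.state ∈ T) : (σ.update D CP T O prec t p).stored p = 1 := by
  simp [VIState.update, hp]

lemma le_stored_update_of_notMem (σ : VIState M) (O : Approx M) (prec : ℕ → ℝ) (t : ℕ)
    {p : M.Pair} (hp : p.state ∉ T) :
    O.exp t p (σ.bound D CP) (prec t) ≤ (σ.update D CP T O prec t p).stored p := by
  simp [VIState.update, hp]

end Bounds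

/-! ### Soundness and monotonicity of the update -/

section Algorithm

variable {S A : Type*} [MetricSpace S] [CompactSpace S] [MeasurableSpace S] [BorelSpace S]
  [MetricSpace A] [CompactSpace A] [MeasurableSpace A] [BorelSpace A]
  {M : MDP S A} {T : Set S} {D : PairMetric M} {CS CP : ℝ}

lemma pairValue_le_one (hT : MeasurableSet T) (p : M.Pair) : M.pairValue T p ≤ 1 :=
  (pairValue_le_value hT p).trans (value_le_one _)

namespace VIState.Sound

variable {σ : VIState M} (hσ : σ.Sound T) (hT : MeasurableSet T)
  (hC : ValueLipschitz D T CS CP)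

include hσ hC hT

lemma pairBound_mem_Icc (p : M.Pair) : σ.pairBound D CP p ∈ Set.Icc (0 : ℝ) 1 :=
  ⟨pairBound_nonneg σ p, (hσ.pairBound_le_pairValue hC p).trans (pairValue_le_one hT p)⟩

lemma bddAbove_pairBound (s : S) :
    BddAbove (Set.range fun a : M.av s => σ.pairBound D CP (M.pair s a)) :=
  ⟨1, by rintro _ ⟨a, rfl⟩; exact (hσ.pairBound_mem_Icc hT hC _).2⟩

lemma pairBound_le_bound (p : M.Pair) : σ.pairBound D CP p ≤ σ.bound D CP p.state :=
  le_ciSup (hσ.bddAbove_pairBound hT hC p.state) ⟨p.1.2, p.2⟩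

lemma bound_le_value (s : S) : σ.bound D CP s ≤ M.value T s := by
  have : Nonempty (M.av s) := (M.av_nonempty s).to_subtype
  exact ciSup_le fun a => (hσ.pairBound_le_pairValue hC _).trans (pairValue_le_value hT _)

lemma bound_mem_Icc (s : S) : σ.bound D CP s ∈ Set.Icc (0 : ℝ) 1 := by
  obtain ⟨a, ha⟩ := M.av_nonempty s
  exact ⟨(pairBound_nonneg σ _).trans (hσ.pairBound_le_bound hT hC ⟨(s, a), ha⟩),
    (hσ.bound_le_value hT hC s).trans (value_le_one s)⟩

lemma measurable_bound (hCP : 0 ≤ CP) : Measurable (σ.bound D CP) :=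
  measurable_maxOver M _ (measurable_pairBound σ)
    (fun s => (exists_lipschitzWith_pairBound hCP σ s).choose_spec.continuous)
    (hσ.bddAbove_pairBound hT hC)

lemma integrable_bound (hCP : 0 ≤ CP) (μ : Measure S) [IsFiniteMeasure μ] :
    Integrable (σ.bound D CP) μ :=
  Integrable.of_bound (hσ.measurable_bound hT hC hCP).aestronglyMeasurable 1
    (Eventually.of_forall fun s => by
      have := hσ.bound_mem_Icc hT hC s
      rw [Real.norm_of_nonneg this.1]; exact this.2)

lemma admissible_bound (hCP : 0 ≤ CP) : D.Admissible (σ.bound D CP) :=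
  ⟨hσ.measurable_bound hT hC hCP, hσ.bound_mem_Icc hT hC, Or.inr ⟨_, CP,
    abs_pairBound_sub_le hCP σ, rfl⟩⟩

/-- Outside the target, the procedure under-approximates the integral of `L`, and `L ≤ V` bounds
this by the pair value. `L` is admissible as a maximum of a Lipschitz pair function. -/
lemma update (hCP : 0 ≤ CP) {O : Approx M} (hO : O.TransApprox D) {prec : ℕ → ℝ}
    (hprec : ∀ t, 0 < prec t) (t : ℕ) (p : M.Pair) :
    (σ.update D CP T O prec t p).Sound T := by
  classical
  intro q
  unfold VIState.update
  by_cases hp : p.state ∈ T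
  · simp only [hp, if_true]
    split_ifs with h
    · exact (pairValue_of_mem (by rwa [h])).ge
    · exact hσ q
  · simp only [hp, if_false]
    rcases eq_or_ne q p with rfl | hqp
    · rw [Function.update_self]
      refine max_le (hσ q) ?_
      rw [pairValue_of_notMem hp]
      have h1 := (hO t q _ (hσ.admissible_bound hT hC hCP) _ (hprec t)).1
      refine (sub_nonneg.1 h1).trans ?_
      exact integral_mono (hσ.integrable_bound hT hC hCP _) (integrable_value hT _)
        (hσ.bound_le_value hT hC)
    · rw [Function.update_of_ne hqp]
      exact hσ q

omit hC

/-- Soundness enters in the target case: overwriting by `1` cannot lower a stored bound that is at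
most the pair value. -/
lemma improves_update (O : Approx M) (prec : ℕ → ℝ) (t : ℕ) (p : M.Pair) :
    σ.Improves (σ.update D CP T O prec t p) := by
  classical
  refine ⟨Finset.subset_insert _ _, fun q => ?_⟩
  unfold VIState.update
  by_cases hp : p.state ∈ T
  · simp only [hp, if_true]
    split_ifs
    · exact (hσ q).trans (pairValue_le_one hT q)
    · exact le_rfl
  · simp only [hp, if_false]
    rcases eq_or_ne q p with rfl | hqp
    · rw [Function.update_self]
      exact le_max_left _ _
    · rw [Function.update_of_ne hqp]

end VIState.Sound

/-! ### Convergence and correctness of the run -/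

section Run

variable (hT : MeasurableSet T) (hC : ValueLipschitz D T CS CP) (hCP : 0 ≤ CP)
  {O : Approx M} (hO : O.TransApprox D) {prec : ℕ → ℝ} (hprec : ∀ t, 0 < prec t)
  (pairs : ℕ → M.Pair)

include hT hC hCP hO hprec

lemma sound_run (t : ℕ) : (run D CP T O prec pairs t).Sound T := by
  induction t with
  | zero => exact fun q => pairValue_nonneg q
  | succ t ih => exact ih.update hT hC hCP hO hprec t (pairs t)

lemma pairBound_run_le_succ (t : ℕ) (p : M.Pair) :
    (run D CP T O prec pairs t).pairBound D CP p ≤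
      (run D CP T O prec pairs (t + 1)).pairBound D CP p :=
  ((sound_run hT hC hCP hO hprec pairs t).improves_update hT O prec t (pairs t)).pairBound_le p

lemma bound_run_mono (s : S) : Monotone fun t => (run D CP T O prec pairs t).bound D CP s := by
  refine monotone_nat_of_le_succ fun t => ?_
  exact ciSup_mono ((sound_run hT hC hCP hO hprec pairs (t + 1)).bddAbove_pairBound hT hC s)
    fun a => pairBound_run_le_succ hT hC hCP hO hprec pairs t _

/-- The effect of sampling a pair near `p` on the bound of the state of `p`. -/
lemma le_bound_run_succ_of_near {p : M.Pair} {t₀ t : ℕ} (ht : t₀ ≤ t) {ε : ℝ}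
    (hd : D.d p (pairs t) < ε)
    (htv : ∀ Y, MeasurableSet Y →
      |(M.trans p.1).real Y - (M.trans (pairs t).1).real Y| ≤ ε) :
    (∫ s, (run D CP T O prec pairs t₀).bound D CP s ∂(M.trans p.1)) - ε - prec t - CP * ε ≤
      (run D CP T O prec pairs (t + 1)).bound D CP p.state := by
  have hsound := sound_run hT hC hCP hO hprec pairs
  have hdCP : CP * D.d p (pairs t) ≤ CP * ε := mul_le_mul_of_nonneg_left hd.le hCP
  have hε : 0 ≤ ε := (D.d_nonneg _ _).trans hd.le
  have hle : (run D CP T O prec pairs (t + 1)).stored (pairs t) - CP * D.d p (pairs t) ≤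
      (run D CP T O prec pairs (t + 1)).bound D CP p.state :=
    (le_pairBound (mem_sampled_update _ O prec t (pairs t)) p).trans
      ((hsound (t + 1)).pairBound_le_bound hT hC p)
  by_cases hq : (pairs t).state ∈ T
  · have h1 : (run D CP T O prec pairs (t + 1)).stored (pairs t) = 1 :=
      stored_update_of_mem _ O prec t hq
    have h2 : ∫ s, (run D CP T O prec pairs t₀).bound D CP s ∂(M.trans p.1) ≤ 1 := by
      refine (integral_mono ((hsound t₀).integrable_bound hT hC hCP _) (integrable_const 1)
        fun s => ((hsound t₀).bound_mem_Icc hT hC s).2).trans ?_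
      simp
    linarith [hprec t]
  · have h1 : O.exp t (pairs t) ((run D CP T O prec pairs t).bound D CP) (prec t) ≤
        (run D CP T O prec pairs (t + 1)).stored (pairs t) :=
      le_stored_update_of_notMem _ O prec t hq
    have h2 := (hO t (pairs t) _ ((hsound t).admissible_bound hT hC hCP) _ (hprec t)).2
    -- The update integrates the current bound at the sampled pair. Monotonicity in time replaces it
    -- by the bound at `t₀`, and closeness of the transition measures moves the integral to `p`.
    have h3 : ∫ s, (run D CP T O prec pairs t₀).bound D CP s ∂(M.trans (pairs t).1) ≤
        ∫ s, (run D CP T O prec pairs t).bound D CP s ∂(M.trans (pairs t).1) :=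
      integral_mono ((hsound t₀).integrable_bound hT hC hCP _)
        ((hsound t).integrable_bound hT hC hCP _)
        fun s => bound_run_mono hT hC hCP hO hprec pairs s ht
    have h4 := integral_le_integral_add_of_abs_measureReal_sub_le (M.trans p.1)
      (M.trans (pairs t).1) htv ((hsound t₀).measurable_bound hT hC hCP)
      ((hsound t₀).bound_mem_Icc hT hC)
    linarith

variable (hprec0 : Tendsto prec atTop (𝓝 0)) {s₀ : S}
  (hpairs : ∀ p : M.Pair, p.state ∈ M.reachable s₀ → ∀ ε > 0, ∃ᶠ t in atTop,
    D.d p (pairs t) < ε ∧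
    (∀ Y, MeasurableSet Y → |(M.trans p.1).real Y - (M.trans (pairs t).1).real Y| ≤ ε) ∧
    (p.state ∈ T → (pairs t).state ∈ T))

include hpairs

lemma exists_le_bound_run_of_mem {p : M.Pair} (hp : p.state ∈ M.reachable s₀) (hpT : p.state ∈ T)
    {η : ℝ} (hη : 0 < η) : ∃ t, 1 - η ≤ (run D CP T O prec pairs t).bound D CP p.state := by
  -- Dividing by `CP + 1` rather than `CP` covers the case `CP = 0`.
  have hCP1 : 0 < CP + 1 := by linarith
  obtain ⟨t, hd, -, hT'⟩ := (hpairs p hp (η / (CP + 1)) (div_pos hη hCP1)).exists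
  refine ⟨t + 1, ?_⟩
  have h1 : (run D CP T O prec pairs (t + 1)).stored (pairs t) = 1 :=
    stored_update_of_mem _ O prec t (hT' hpT)
  have h2 : (run D CP T O prec pairs (t + 1)).stored (pairs t) - CP * D.d p (pairs t) ≤
      (run D CP T O prec pairs (t + 1)).bound D CP p.state :=
    (le_pairBound (mem_sampled_update _ O prec t (pairs t)) p).trans
      ((sound_run hT hC hCP hO hprec pairs (t + 1)).pairBound_le_bound hT hC p)
  have h3 : CP * D.d p (pairs t) ≤ (CP + 1) * (η / (CP + 1)) :=
    mul_le_mul (by linarith) hd.le (D.d_nonneg _ _) hCP1.le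
  rw [mul_div_cancel₀ _ hCP1.ne'] at h3
  linarith

include hprec0

lemma exists_integral_sub_le_bound_run {p : M.Pair} (hp : p.state ∈ M.reachable s₀) (t₀ : ℕ)
    {η : ℝ} (hη : 0 < η) :
    ∃ t, (∫ s, (run D CP T O prec pairs t₀).bound D CP s ∂(M.trans p.1)) - η ≤
      (run D CP T O prec pairs t).bound D CP p.state := by
  -- The error budget: one share each for total variation and precision, and `CP` shares for
  -- extrapolation.
  have hCP2 : 0 < CP + 2 := by linarith
  have hε : 0 < η / (CP + 2) := div_pos hη hCP2
  obtain ⟨t, ⟨hd, htv, -⟩, ht, hpt⟩ := ((hpairs p hp _ hε).and_eventually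
    ((eventually_ge_atTop t₀).and (hprec0.eventually_lt_const hε))).exists
  refine ⟨t + 1, le_trans ?_
    (le_bound_run_succ_of_near hT hC hCP hO hprec pairs ht hd htv)⟩
  have : (CP + 2) * (η / (CP + 2)) = η := mul_div_cancel₀ _ hCP2.ne'
  linarith

open scoped ENNReal

/-- The induction runs over all reachable states at once, because almost every successor of a
reachable state is reachable. Monotone convergence leaves a fixed `t₀`, which a sufficiently late
sample near the pair exploits. -/
lemma horizonValue_le_iSup_bound_run (k : ℕ) {s : S} (hs : s ∈ M.reachable s₀) :
    M.horizonValue T k s ≤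
      ⨆ t, ENNReal.ofReal ((run D CP T O prec pairs t).bound D CP s) := by
  have hsound := sound_run hT hC hCP hO hprec pairs
  have hlim : ∀ {c : ℝ} {s : S}, 0 ≤ c →
      (∀ η > 0, ∃ t, c - η ≤ (run D CP T O prec pairs t).bound D CP s) →
      ENNReal.ofReal c ≤ ⨆ t, ENNReal.ofReal ((run D CP T O prec pairs t).bound D CP s) := by
    intro c s hc h
    refine ENNReal.le_of_forall_pos_le_add fun η hη _ => ?_
    obtain ⟨t, ht⟩ := h η hη
    calc ENNReal.ofReal c
        ≤ ENNReal.ofReal ((run D CP T O prec pairs t).bound D CP s + η) :=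
          ENNReal.ofReal_le_ofReal (by linarith)
      _ ≤ ENNReal.ofReal ((run D CP T O prec pairs t).bound D CP s) + η := by
          rw [ENNReal.ofReal_add ((hsound t).bound_mem_Icc hT hC s).1 η.coe_nonneg,
            ENNReal.ofReal_coe_nnreal]
      _ ≤ _ := add_le_add_left
          (le_iSup (fun t => ENNReal.ofReal ((run D CP T O prec pairs t).bound D CP s)) t) _
  induction k generalizing s with
  | zero =>
    refine iSup₂_le fun a ha => ?_
    by_cases hsT : s ∈ T
    · rw [horizonPairValue_of_mem hsT, ← ENNReal.ofReal_one]
      exact hlim zero_le_one fun η hη => exists_le_bound_run_of_mem hT hC hCP hO hprec pairs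
        hpairs (p := ⟨(s, a), ha⟩) hs hsT hη
    · rw [horizonPairValue_zero_of_notMem hsT]; exact zero_le
  | succ k ih =>
    refine iSup₂_le fun a ha => ?_
    by_cases hsT : s ∈ T
    · rw [horizonPairValue_of_mem hsT, ← ENNReal.ofReal_one]
      exact hlim zero_le_one fun η hη => exists_le_bound_run_of_mem hT hC hCP hO hprec pairs
        hpairs (p := ⟨(s, a), ha⟩) hs hsT hη
    rw [horizonPairValue_succ_of_notMem hsT]
    have hle : ∀ᵐ s' ∂(M.trans (s, a)), M.horizonValue T k s' ≤
        ⨆ t, ENNReal.ofReal ((run D CP T O prec pairs t).bound D CP s') := by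
      filter_upwards [Measure.support_mem_ae (μ := M.trans (s, a))] with s' hs'
      exact ih (mem_reachable_of_mem_support hs ha hs')
    refine (lintegral_mono_ae hle).trans ?_
    rw [lintegral_iSup (fun t => ((hsound t).measurable_bound hT hC hCP).ennreal_ofReal)
      fun i j hij s' => ENNReal.ofReal_le_ofReal
        (bound_run_mono hT hC hCP hO hprec pairs s' hij)]
    refine iSup_le fun t₀ => ?_
    rw [← ofReal_integral_eq_lintegral_ofReal ((hsound t₀).integrable_bound hT hC hCP _)
      (Eventually.of_forall fun s' => ((hsound t₀).bound_mem_Icc hT hC s').1)]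
    exact hlim (integral_nonneg fun s' => ((hsound t₀).bound_mem_Icc hT hC s').1) fun η hη =>
      exists_integral_sub_le_bound_run hT hC hCP hO hprec pairs hprec0 hpairs
        (p := ⟨(s, a), ha⟩) hs t₀ hη

/-- The bounds of a reachable state converge to its value. -/
theorem tendsto_bound_run {s : S} (hs : s ∈ M.reachable s₀) :
    Tendsto (fun t => (run D CP T O prec pairs t).bound D CP s) atTop (𝓝 (M.value T s)) := by
  have hsound := sound_run hT hC hCP hO hprec pairs
  refine tendsto_atTop_isLUB (bound_run_mono hT hC hCP hO hprec pairs s) ⟨?_, fun b hb => ?_⟩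
  · rintro _ ⟨t, rfl⟩
    exact (hsound t).bound_le_value hT hC s
  · have hb0 : 0 ≤ b := ((hsound 0).bound_mem_Icc hT hC s).1.trans (hb ⟨0, rfl⟩)
    rw [← ENNReal.ofReal_le_ofReal_iff hb0, ofReal_value hT]
    refine iSup_le fun k => (horizonValue_le_iSup_bound_run hT hC hCP hO hprec pairs hprec0
      hpairs k hs).trans (iSup_le fun t => ENNReal.ofReal_le_ofReal (hb ⟨t, rfl⟩))

omit hprec0 hpairs

variable (hmax : O.MaxApprox) {ξ : ℝ}

include hmax

lemma maxAv_run_bounds (t : ℕ) (s : S) :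
    (run D CP T O prec pairs t).bound D CP s - prec t ≤
        O.maxAv t s (fun a => (run D CP T O prec pairs t).pairBound D CP (M.pair s a)) (prec t) ∧
      O.maxAv t s (fun a => (run D CP T O prec pairs t).pairBound D CP (M.pair s a)) (prec t) ≤
        (run D CP T O prec pairs t).bound D CP s := by
  have h := hmax t s (fun a => (run D CP T O prec pairs t).pairBound D CP (M.pair s a))
    (fun a => (sound_run hT hC hCP hO hprec pairs t).pairBound_mem_Icc hT hC _)
    (exists_lipschitzWith_pairBound hCP _ s) (prec t) (hprec t)
  have hb : (run D CP T O prec pairs t).bound D CP s =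
      ⨆ a : M.av s, (run D CP T O prec pairs t).pairBound D CP (M.pair s a) := rfl
  rw [hb]
  exact ⟨by linarith [h.2], by linarith [h.1]⟩

lemma lt_value_of_answersYes (h : AnswersYes D CP T O prec pairs s₀ ξ) : ξ < M.value T s₀ := by
  obtain ⟨t, ht⟩ := h
  exact (not_le.1 ht).trans_le
    ((maxAv_run_bounds hT hC hCP hO hprec pairs hmax t s₀).2.trans
      ((sound_run hT hC hCP hO hprec pairs t).bound_le_value hT hC s₀))

include hprec0

/-- The value used in the loop test is at least `L_t(s₀) - prec t`, which still converges to the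
value and so eventually exceeds `ξ`. -/
lemma answersYes_of_lt_value (hlim : Tendsto (fun t => (run D CP T O prec pairs t).bound D CP s₀)
    atTop (𝓝 (M.value T s₀))) (h : ξ < M.value T s₀) : AnswersYes D CP T O prec pairs s₀ ξ := by
  have hlim' := hlim.sub hprec0
  rw [sub_zero] at hlim'
  obtain ⟨t, ht⟩ := (hlim'.eventually_const_lt h).exists
  exact ⟨t, not_le.2 (ht.trans_le (maxAv_run_bounds hT hC hCP hO hprec pairs hmax t s₀).1)⟩

end Run

end Algorithm

end ReachMDP

end

theorem theorem4 {S A : Type*}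
    [MetricSpace S] [CompactSpace S] [MeasurableSpace S] [BorelSpace S]
    [MetricSpace A] [CompactSpace A] [MeasurableSpace A] [BorelSpace A]
    (M : ReachMDP.MDP S A) (T : Set S) (hT : MeasurableSet T) (s₀ : S)
    (ξ : ℝ) (hξ : ξ ∈ Set.Icc (0 : ℝ) 1)
    (D : ReachMDP.PairMetric M) (CS CP : ℝ) (hCS : 0 ≤ CS) (hCP : 0 ≤ CP)
    (hC : ReachMDP.ValueLipschitz D T CS CP)
    {Ω : Type*} [MeasurableSpace Ω] (P : Measure Ω) [IsProbabilityMeasure P]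
    (O : Ω → ReachMDP.Approx M)
    (hmax : ∀ ω, (O ω).MaxApprox) (htrans : ∀ ω, (O ω).TransApprox D)
    (prec : ℕ → ℝ) (hprec : ∀ t, 0 < prec t) (hprec0 : Tendsto prec atTop (𝓝 0))
    (getPair : ℕ → Ω → M.Pair) (hmeas : ∀ t, Measurable (getPair t))
    (hsample : ReachMDP.Sampling D T s₀ P getPair) :
    let σ : Ω → ℕ → ReachMDP.VIState M := fun ω =>
      ReachMDP.run D CP T (O ω) prec (fun t => getPair t ω)
    (∀ ω t, (∀ p, (σ ω t).pairBound D CP p ≤ (σ ω (t + 1)).pairBound D CP p ∧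
        (σ ω (t + 1)).pairBound D CP p ≤ M.pairValue T p) ∧
      ∀ s, (σ ω t).bound D CP s ≤ (σ ω (t + 1)).bound D CP s ∧
        (σ ω (t + 1)).bound D CP s ≤ M.value T s) ∧
    (∀ ω, ReachMDP.AnswersYes D CP T (O ω) prec (fun t => getPair t ω) s₀ ξ →
      ξ < M.value T s₀) ∧
    ∀ᵐ ω ∂P, Tendsto (fun t => (σ ω t).bound D CP s₀) atTop (𝓝 (M.value T s₀)) ∧
      (ReachMDP.AnswersYes D CP T (O ω) prec (fun t => getPair t ω) s₀ ξ ↔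
        ξ < M.value T s₀) := by
  have hsound := fun ω => ReachMDP.sound_run hT hC hCP (htrans ω) hprec fun t => getPair t ω
  refine ⟨fun ω t => ⟨fun p => ⟨?_, ?_⟩, fun s => ⟨?_, ?_⟩⟩, fun ω => ?_, ?_⟩
  · exact ReachMDP.pairBound_run_le_succ hT hC hCP (htrans ω) hprec _ t p
  · exact (hsound ω (t + 1)).pairBound_le_pairValue hC p
  · exact ReachMDP.bound_run_mono hT hC hCP (htrans ω) hprec _ s t.le_succ
  · exact (hsound ω (t + 1)).bound_le_value hT hC s
  · exact ReachMDP.lt_value_of_answersYes hT hC hCP (htrans ω) hprec _ (hmax ω)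
  · filter_upwards [hsample.ae_forall_frequently hT hmeas] with ω hω
    have hlim := ReachMDP.tendsto_bound_run hT hC hCP (htrans ω) hprec _ hprec0 hω
      (ReachMDP.self_mem_reachable M s₀)
    exact ⟨hlim, ReachMDP.lt_value_of_answersYes hT hC hCP (htrans ω) hprec _ (hmax ω),
      ReachMDP.answersYes_of_lt_value hT hC hCP (htrans ω) hprec _ hprec0 (hmax ω) hlim⟩
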